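/- **Model.** Let $G$ be a simple graph on the vertices $1,\dots,n$ with $m$ edges. Each edge is held by exactly one of $m$ stations, whose identifiers are $1,\dots,m$ (the stations do not know $m$). In each synchronous step some stations broadcast on a multiple-access channel with collision detection: if exactly one station broadcasts, all stations hear its message; if none does, all hear silence; if at least two do, all hear noise (a collision). A *spanning forest* of $G$ is always a maximal one: a set $T$ of edges of $G$ containing no cycle such that adding any other edge of $G$ to $T$ creates a cycle; $|T|$ is its number of edges. **Algorithm RandSimple.** All edges are initially *waiting*, and every station keeps a number $a:=1$, a counter $:=0$, and the set of *revealed* edges, initially empty. Whenever an edge is heard on the channel: if it is waiting, it becomes revealed; then every other waiting edge that makes a cycle together with revealed edges becomes a *cycle* edge. The stations repeat the following round of three steps: - Step A: each station holding a waiting edge broadcasts it with probability $1/a$, all these random trials (over steps and stations) being independent. If noise is heard, then $a:=3a$; if silence is heard, then $a:=\max\{a/3,1\}$. The counter is then increased by $1$. - Step C: the station whose identifier equals the counter (if any) broadcasts its edge, whatever the status of the edge. - Step D: each station holding a waiting edge broadcasts a dummy message. If silence is heard in this step, all stations terminate, and the set of revealed edges is the output. The running time is the number of steps until all stations have terminated.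 **Theorem.** There is an absolute constant $C$ such that for every such input the following hold. 1. For all outcomes of the random trials, RandSimple terminates within $C\,m$ steps. Its output, known to every station, is a spanning forest $T$ of $G$; each edge of $T$ was heard on the channel at some step; and the edges whose status at their own station is revealed are exactly those of $T$. 2. The running time is a random variable, and for every spanning forest $T$ of $G$ (in particular, for the one that is found) its expectation $\mathbb{E}$ satisfies $|T|\le \mathbb{E}\le C\,|T|$. -/

import Mathlib

open MeasureTheory ProbabilityTheory
open scoped ENNReal

/-! ### Multiple-access channel with collision detection -/

/-- What all the stations hear on the channel in one step. -/
inductive Feedback (Msg : Type) : Type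
  | silence : Feedback Msg
  | heard (x : Msg) : Feedback Msg
  | noise : Feedback Msg

open Classical in
/-- The channel: `b p` says that station `p` broadcasts, and `msg p` is the message it sends.
The message is delivered iff exactly one station broadcasts; several broadcasts are heard as
noise (a collision). -/
noncomputable def channel {ι Msg : Type} (b : ι → Prop) (msg : ι → Msg) : Feedback Msg :=
  if h : ∃! p, b p then .heard (msg h.choose)
  else if ∃ p, b p then .noise
  else .silence

/-- The code of a station in a synchronous randomized algorithm. `Inp` is the input of a station,
`St` its local memory. In a step, a station with input `i` and memory `s` broadcasts the message
`msg i s` with probability `prob i s` (`0`: it stays silent, `1`: it surely broadcasts), hears the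
feedback `f` of the channel, and changes its memory to `next i s f`. -/
structure Protocol (Inp St Msg : Type) where
  init : St
  prob : Inp → St → ℝ
  msg : Inp → St → Msg
  next : Inp → St → Feedback Msg → St
  halted : St → Prop

namespace Protocol

variable {ι Inp St Msg : Type}

/-- Station `p` broadcasts if it has not halted and its random trial succeeds. The trial is decided
by a number `x p` in `[0,1)`: it is a success iff `x p` is less than the prescribed probability. -/
def Broadcasts (A : Protocol Inp St Msg) (inp : ι → Inp) (x : ι → ℝ) (s : ι → St) (p : ι) : Prop :=
  ¬ A.halted (s p) ∧ x p < A.prob (inp p) (s p)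

/-- The feedback heard in a step. -/
noncomputable def feedback (A : Protocol Inp St Msg) (inp : ι → Inp) (x : ι → ℝ) (s : ι → St) :
    Feedback Msg :=
  channel (A.Broadcasts inp x s) (fun p => A.msg (inp p) (s p))

open Classical in
/-- The memories of the stations after a step. -/
noncomputable def step (A : Protocol Inp St Msg) (inp : ι → Inp) (x : ι → ℝ) (s : ι → St) :
    ι → St :=
  fun p => if A.halted (s p) then s p else A.next (inp p) (s p) (A.feedback inp x s)

/-- The memories of the stations after `t` steps; `u t p` decides the trial of station `p` in the
step with index `t`. -/
noncomputable def run (A : Protocol Inp St Msg) (inp : ι → Inp) (u : ℕ → ι → ℝ) : ℕ → ι → St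
  | 0 => fun _ => A.init
  | t + 1 => A.step inp (u t) (A.run inp u t)

/-- The feedback heard in the step with index `t` of the execution. -/
noncomputable def feedbackAt (A : Protocol Inp St Msg) (inp : ι → Inp) (u : ℕ → ι → ℝ) (t : ℕ) :
    Feedback Msg :=
  A.feedback inp (u t) (A.run inp u t)

/-- The running time: the number of steps until all the stations have halted (`⊤` if never). -/
noncomputable def time (A : Protocol Inp St Msg) (inp : ι → Inp) (u : ℕ → ι → ℝ) : ℕ∞ :=
  ⨅ (k : ℕ) (_ : ∀ p, A.halted (A.run inp u k p)), (k : ℕ∞)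

end Protocol

/-! ### Spanning forests -/

/-- The edges in `R` make a forest. -/
def IsForest {V : Type} (R : Finset (Sym2 V)) : Prop :=
  (SimpleGraph.fromEdgeSet (R : Set (Sym2 V))).IsAcyclic

/-- `T` is (the edge set of) a maximal spanning forest of `G`: a forest of edges of `G` such that
adding a new edge of `G` always creates a cycle. -/
def IsSpanningForest {V : Type} [DecidableEq V] (G : SimpleGraph V) (T : Finset (Sym2 V)) : Prop :=
  (T : Set (Sym2 V)) ⊆ G.edgeSet ∧ IsForest T ∧
    ∀ e ∈ G.edgeSet, e ∉ T → ¬ IsForest (insert e T)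

/-! ### The algorithm RandSimple -/

namespace RandSimple

/-- A message is an edge or a dummy message. -/
inductive Msg (n : ℕ) : Type
  | edge (e : Sym2 (Fin n)) : Msg n
  | dummy : Msg n

/-- The input of a station: its identifier and the edge it holds. -/
structure Input (n : ℕ) : Type where
  id : ℕ
  edge : Sym2 (Fin n)

inductive Status : Type
  | waiting | revealed | cycle

/-- The next broadcasting step (A, C or D) in the main loop; `done` after termination. -/
inductive Label : Type
  | A | C | D | done

/-- The memory of a station; `status` is the status of its own edge, and `revealed` is the set of
the edges that it knows to be revealed. -/
structure Memory (n : ℕ) : Type where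
  label : Label
  a : ℚ
  counter : ℕ
  status : Status
  revealed : Finset (Sym2 (Fin n))

open Classical in
/-- The set of revealed edges after `e` has been heard. A heard edge is new to this set unless it
is already revealed or it is a cycle edge (step C broadcasts edges of any status). -/
noncomputable def addRevealed {n : ℕ} (R : Finset (Sym2 (Fin n))) (e : Sym2 (Fin n)) :
    Finset (Sym2 (Fin n)) :=
  if IsForest (insert e R) then insert e R else R

open Classical in
/-- The new status of the edge `own` when the edge `e` has been heard and `R` is the resulting set
of revealed edges. Only a waiting edge changes its status: to revealed if it was heard itself, and
to cycle if another edge was heard and `own` now makes a cycle with the revealed edges. -/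
noncomputable def newStatus {n : ℕ} (own e : Sym2 (Fin n)) (R : Finset (Sym2 (Fin n))) :
    Status → Status
  | .waiting => if e = own then .revealed else if IsForest (insert own R) then .waiting else .cycle
  | .revealed => .revealed
  | .cycle => .cycle

/-- A station that holds `own` hears the edge `e`. -/
noncomputable def hear {n : ℕ} (own : Sym2 (Fin n)) (s : Memory n) (e : Sym2 (Fin n)) : Memory n :=
  { s with
    revealed := addRevealed s.revealed e
    status := newStatus own e (addRevealed s.revealed e) s.status }

/-- Reaction to the feedback of step A. -/
noncomputable def afterA {n : ℕ} (own : Sym2 (Fin n)) (s : Memory n) :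
    Feedback (Msg n) → Memory n
  | .heard (.edge e) => hear own s e
  | .heard .dummy => s
  | .noise => { s with a := 3 * s.a }
  | .silence => { s with a := max (s.a / 3) 1 }

/-- Reaction to the feedback of step C. -/
noncomputable def afterC {n : ℕ} (own : Sym2 (Fin n)) (s : Memory n) :
    Feedback (Msg n) → Memory n
  | .heard (.edge e) => hear own s e
  | .heard .dummy => s
  | .noise => s
  | .silence => s

/-- The label after step D: the main loop is repeated until silence is heard in step D. -/
def afterD {n : ℕ} : Feedback (Msg n) → Label
  | .silence => .done
  | .heard _ => .A
  | .noise => .A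

open Classical in
/-- The probability with which a station broadcasts. Step A: a waiting station, with probability
`1/a`; step C: the station whose identifier is the counter; step D: all waiting stations. -/
noncomputable def prob {n : ℕ} (i : Input n) (s : Memory n) : ℝ :=
  match s.label with
  | .A => if s.status = .waiting then ((1 / s.a : ℚ) : ℝ) else 0
  | .C => if i.id = s.counter then 1 else 0
  | .D => if s.status = .waiting then 1 else 0
  | .done => 0

/-- The message that a station sends if it broadcasts. -/
def msg {n : ℕ} (i : Input n) (s : Memory n) : Msg n :=
  match s.label with
  | .A => .edge i.edge
  | .C => .edge i.edge
  | .D => .dummy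
  | .done => .dummy

noncomputable def next {n : ℕ} (i : Input n) (s : Memory n) (f : Feedback (Msg n)) : Memory n :=
  match s.label with
  | .A => { afterA i.edge s f with counter := s.counter + 1, label := .C }
  | .C => { afterC i.edge s f with label := .D }
  | .D => { s with label := afterD f }
  | .done => s

/-- The algorithm RandSimple. -/
noncomputable def algorithm (n : ℕ) : Protocol (Input n) (Memory n) (Msg n) where
  init := { label := .A, a := 1, counter := 0, status := .waiting, revealed := ∅ }
  prob := prob
  msg := msg
  next := next
  halted := fun s => s.label = .done

/-- The distributed input: the edges of `G` are held by `m` stations, one edge each; the station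
with index `p` in `{0,…,m-1}` has the identifier `p + 1`. -/
def input {n m : ℕ} {G : SimpleGraph (Fin n)} (edge : Fin m ≃ G.edgeSet) (p : Fin m) : Input n where
  id := p + 1
  edge := edge p

end RandSimple

/-! ### Forests -/

section Forests

variable {V : Type}

/-! All stations hear the same feedback, and the status of an edge is a function of the set `R` of
revealed edges. Hence an execution is a single process on a common state (`run_eq_view`). In it `R`
stays a forest, and silence in step D says that no edge of `G` extends it. Step C makes termination
certain: once round `c` is over, the edges of stations `1, …, c` are not waiting, so `m` rounds
suffice for any outcome of the trials.

The lower bound on time holds pointwise: each edge of the output was heard, and a step delivers at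
most one edge. All spanning forests have equal size because that size is the rank of the space
spanned by the vectors `e_u - e_v` over the edges `uv`.

The upper bound is an additive drift argument. Let `w` be the number of waiting edges, `a = 3 ^ j`,
and let `L` be the logarithm of `2w` to base 3, rounded up. A round decreases `15 (|T| - |R|) + L +
|j - L|` by at least 1 in expectation (`backoff_drift`): for `j < L` silence is at most 6 times as
likely as a success, for `j > L` noise is at most as likely as a success, and at `j = L` a success,
which is worth 15, has probability at least `1/8`. Step C can only enlarge `R`, which does not
increase the potential. Since `m ≤ |T| (2|T| + 1)`, initially `L ≤ 2|T|`, so the potential starts at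
no more than `19 |T|`. With three steps per round this gives `57 |T|`. The drift becomes a bound on
the mean because the trials of a step are independent of the state before it
(`lintegral_globalRun_succ`). -/

theorem IsForest.anti {R S : Finset (Sym2 V)} (h : R ⊆ S) (hS : IsForest S) : IsForest R :=
  SimpleGraph.IsAcyclic.anti (SimpleGraph.fromEdgeSet_mono (by exact_mod_cast h)) hS

theorem isForest_empty : IsForest (∅ : Finset (Sym2 V)) := by
  simp [IsForest]

theorem fromEdgeSet_insert [DecidableEq V] (R : Finset (Sym2 V)) (u v : V) :
    SimpleGraph.fromEdgeSet ((insert s(u, v) R : Finset (Sym2 V)) : Set (Sym2 V)) =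
      SimpleGraph.fromEdgeSet (R : Set (Sym2 V)) ⊔ SimpleGraph.edge u v := by
  rw [SimpleGraph.edge, ← SimpleGraph.fromEdgeSet_union]
  congr 1
  ext e
  simp [or_comm]

theorem isForest_insert_iff [DecidableEq V] {R : Finset (Sym2 V)} {u v : V} (huv : u ≠ v)
    (he : s(u, v) ∉ R) :
    IsForest (insert s(u, v) R) ↔
      IsForest R ∧ ¬ (SimpleGraph.fromEdgeSet (R : Set (Sym2 V))).Reachable u v := by
  rw [IsForest, fromEdgeSet_insert, SimpleGraph.isAcyclic_sup_fromEdgeSet_iff]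
  simp [IsForest, huv, he]

theorem isForest_singleton [DecidableEq V] (e : Sym2 V) : IsForest ({e} : Finset (Sym2 V)) := by
  induction e with
  | _ u v =>
    have h := fromEdgeSet_insert (∅ : Finset (Sym2 V)) u v
    rw [insert_empty_eq] at h
    rw [IsForest, h, SimpleGraph.isAcyclic_sup_fromEdgeSet_iff]
    simp +contextual

/-- The space spanned by the differences of adjacent vertices. -/
def edgeSpace [DecidableEq V] (G : SimpleGraph V) : Submodule ℚ (V → ℚ) :=
  Submodule.span ℚ {x | ∃ u v, G.Adj u v ∧ x = Pi.single u 1 - Pi.single v 1}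

theorem not_isDiag_of_subset_edgeSet {G : SimpleGraph V} {R : Finset (Sym2 V)}
    (hRG : (R : Set (Sym2 V)) ⊆ G.edgeSet) : ∀ e ∈ R, ¬ e.IsDiag :=
  fun _ he => G.not_isDiag_of_mem_edgeSet (hRG he)

variable [DecidableEq V]

theorem edgeSpace_mono {G H : SimpleGraph V} (h : G ≤ H) : edgeSpace G ≤ edgeSpace H :=
  Submodule.span_mono (by rintro x ⟨u, v, huv, rfl⟩; exact ⟨u, v, h huv, rfl⟩)

/-- The differences along a walk telescope. -/
theorem single_sub_single_mem_edgeSpace {G : SimpleGraph V} {u v : V} (h : G.Reachable u v) :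
    (Pi.single u 1 - Pi.single v 1 : V → ℚ) ∈ edgeSpace G := by
  obtain ⟨p⟩ := h
  induction p with
  | nil => simp
  | cons hadj p ih =>
    rw [← sub_add_sub_cancel]
    exact add_mem (Submodule.subset_span ⟨_, _, hadj, rfl⟩) ih

/-- The sum of the coordinates over the component of `u` is a linear functional that vanishes on
every edge but equals 1 on this vector. -/
theorem single_sub_single_notMem_edgeSpace [Fintype V] {G : SimpleGraph V} {u v : V}
    (h : ¬ G.Reachable u v) : (Pi.single u 1 - Pi.single v 1 : V → ℚ) ∉ edgeSpace G := by
  classical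
  intro hmem
  let c : V → ℚ := fun w => if G.Reachable u w then 1 else 0
  let φ : (V → ℚ) →ₗ[ℚ] ℚ := Fintype.linearCombination ℚ c
  have hφ : ∀ a b, φ (Pi.single a 1 - Pi.single b 1) = c a - c b := by
    intro a b
    simp [φ]
  have hle : edgeSpace G ≤ LinearMap.ker φ := by
    refine Submodule.span_le.2 ?_
    rintro x ⟨a, b, hab, rfl⟩
    have : G.Reachable u a ↔ G.Reachable u b :=
      ⟨fun hr => hr.trans hab.reachable, fun hr => hr.trans hab.symm.reachable⟩
    simp [hφ, c, this]
  have := LinearMap.mem_ker.1 (hle hmem)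
  rw [hφ] at this
  simp [c, h] at this

theorem edgeSpace_sup_edge (G : SimpleGraph V) {u v : V} (huv : u ≠ v) :
    edgeSpace (G ⊔ SimpleGraph.edge u v) =
      edgeSpace G ⊔ Submodule.span ℚ {Pi.single u 1 - Pi.single v 1} := by
  apply le_antisymm
  · refine Submodule.span_le.2 ?_
    rintro x ⟨a, b, hab, rfl⟩
    rw [SimpleGraph.sup_adj, SimpleGraph.edge_adj] at hab
    rcases hab with hab | ⟨⟨rfl, rfl⟩ | ⟨rfl, rfl⟩, -⟩
    · exact Submodule.mem_sup_left (Submodule.subset_span ⟨_, _, hab, rfl⟩)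
    · exact Submodule.mem_sup_right (Submodule.mem_span_singleton_self _)
    · refine Submodule.mem_sup_right ?_
      exact Submodule.mem_span_singleton.2 ⟨-1, by simp⟩
  · refine sup_le (edgeSpace_mono le_sup_left) ?_
    rw [Submodule.span_singleton_le_iff_mem]
    refine Submodule.subset_span ⟨u, v, ?_, rfl⟩
    simp [SimpleGraph.edge_adj, huv]

/-- Each new edge of a forest joins two components, so its vector is independent of the earlier
ones. Loops must be excluded: they are not seen by `SimpleGraph.fromEdgeSet`, but they count in the
cardinality. -/
theorem IsForest.finrank_edgeSpace [Fintype V] {R : Finset (Sym2 V)} (hR : IsForest R)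
    (hd : ∀ e ∈ R, ¬ e.IsDiag) :
    Module.finrank ℚ (edgeSpace (SimpleGraph.fromEdgeSet (R : Set (Sym2 V)))) = R.card := by
  induction R using Finset.induction_on with
  | empty =>
    have : edgeSpace (SimpleGraph.fromEdgeSet ((∅ : Finset (Sym2 V)) : Set (Sym2 V))) = ⊥ :=
      Submodule.span_eq_bot.2 (by rintro x ⟨u, v, h, rfl⟩; simp at h)
    rw [this, finrank_bot, Finset.card_empty]
  | insert e R he ih =>
    induction e with
    | _ u v =>
      have huv : u ≠ v := by simpa using hd s(u, v) (by simp)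
      obtain ⟨hR', hr⟩ := (isForest_insert_iff huv he).1 hR
      have ih' := ih hR' fun e' h' => hd e' (by simp [h'])
      rw [fromEdgeSet_insert, edgeSpace_sup_edge _ huv, Finset.card_insert_of_notMem he, ← ih']
      exact Submodule.finrank_sup_span_singleton (single_sub_single_notMem_edgeSpace hr)

theorem IsSpanningForest.reachable {G : SimpleGraph V} {T : Finset (Sym2 V)}
    (hT : IsSpanningForest G T) {u v : V} (h : G.Adj u v) :
    (SimpleGraph.fromEdgeSet (T : Set (Sym2 V))).Reachable u v := by
  by_cases he : s(u, v) ∈ T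
  · exact SimpleGraph.Adj.reachable (by simp [he, h.ne])
  · by_contra hr
    exact hT.2.2 _ h he ((isForest_insert_iff h.ne he).2 ⟨hT.2.1, hr⟩)

/-- A spanning forest connects the ends of every edge of `G`, so its edge space contains that of
`R`, and the ranks are the cardinalities. -/
theorem IsForest.card_le [Fintype V] {G : SimpleGraph V} {R T : Finset (Sym2 V)}
    (hR : IsForest R) (hRG : (R : Set (Sym2 V)) ⊆ G.edgeSet) (hT : IsSpanningForest G T) :
    R.card ≤ T.card := by
  rw [← hR.finrank_edgeSpace (not_isDiag_of_subset_edgeSet hRG),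
    ← hT.2.1.finrank_edgeSpace (not_isDiag_of_subset_edgeSet hT.1)]
  apply Submodule.finrank_mono
  refine Submodule.span_le.2 ?_
  rintro x ⟨u, v, huv, rfl⟩
  refine single_sub_single_mem_edgeSpace (hT.reachable (SimpleGraph.mem_edgeSet _ |>.1 (hRG ?_)))
  exact (SimpleGraph.fromEdgeSet_adj _).1 huv |>.1

theorem IsSpanningForest.card_eq [Fintype V] {G : SimpleGraph V} {S T : Finset (Sym2 V)}
    (hS : IsSpanningForest G S) (hT : IsSpanningForest G T) : S.card = T.card :=
  le_antisymm (hS.2.1.card_le hS.1 hT) (hT.2.1.card_le hT.1 hS)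

/-- The edges of a graph join vertices that are covered by a given spanning forest, so that their
number is at most quadratic in the size of the forest. -/
theorem IsSpanningForest.card_edgeSet_le [Fintype V] {G : SimpleGraph V} {T : Finset (Sym2 V)}
    (hT : IsSpanningForest G T) : Nat.card G.edgeSet ≤ T.card * (2 * T.card + 1) := by
  classical
  let S : Finset V := T.biUnion fun e => e.toFinset
  have hS : S.card ≤ 2 * T.card := by
    rw [mul_comm]
    refine Finset.card_biUnion_le_card_mul _ _ _ fun e _ => ?_
    rw [Sym2.card_toFinset]
    split_ifs <;> simp
  have hcov : ∀ {u v : V}, G.Adj u v → u ∈ S := by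
    intro u v h
    -- The first edge of a walk in `T` from `u` to `v` covers `u`; the walk is not empty because `u
    -- ≠ v`.
    obtain ⟨p⟩ := hT.reachable h
    cases p with
    | nil => exact absurd h (G.loopless.irrefl _)
    | cons hadj p =>
      rw [Finset.mem_biUnion]
      exact ⟨_, (SimpleGraph.fromEdgeSet_adj _).1 hadj |>.1, by simp⟩
  have hsub : G.edgeSet ⊆ (S.sym2 : Set (Sym2 V)) := by
    intro e
    induction e with
    | _ u v =>
      intro h
      rw [Finset.mem_coe, Finset.mk_mem_sym2_iff]
      exact ⟨hcov h, hcov (SimpleGraph.Adj.symm h)⟩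
  calc Nat.card G.edgeSet ≤ Nat.card (S.sym2 : Set (Sym2 V)) :=
        Nat.card_mono (Finset.finite_toSet _) hsub
    _ = (S.card + 1).choose 2 := by
        rw [Nat.card_eq_card_toFinset, Finset.toFinset_coe, Finset.card_sym2]
    _ ≤ (2 * T.card + 1).choose 2 := Nat.choose_le_choose 2 (by omega)
    _ = T.card * (2 * T.card + 1) := by
        rw [Nat.choose_two_right]
        apply Nat.div_eq_of_eq_mul_right two_pos
        rw [Nat.add_sub_cancel]
        ring

end Forests

/-! ### Feedback of the channel -/

section Channel

variable {ι M : Type}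

theorem channel_of_forall_not {b : ι → Prop} (msg : ι → M) (h : ∀ p, ¬ b p) :
    channel b msg = .silence := by
  have h1 : ¬ ∃! p, b p := fun ⟨p, hp, _⟩ => h p hp
  have h2 : ¬ ∃ p, b p := fun ⟨p, hp⟩ => h p hp
  simp [channel, h1, h2]

theorem channel_of_unique {b : ι → Prop} (msg : ι → M) {p : ι} (hp : b p)
    (h : ∀ q, b q → q = p) : channel b msg = .heard (msg p) := by
  have h1 : ∃! p, b p := ⟨p, hp, h⟩
  rw [channel, dif_pos h1, h _ h1.choose_spec.1]

theorem channel_of_not_existsUnique {b : ι → Prop} (msg : ι → M) (h : ∃ p, b p)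
    (h1 : ¬ ∃! p, b p) : channel b msg = .noise := by
  simp [channel, h1, h]

theorem channel_eq_silence_iff {b : ι → Prop} {msg : ι → M} :
    channel b msg = .silence ↔ ∀ p, ¬ b p := by
  refine ⟨fun h p hp => ?_, channel_of_forall_not msg⟩
  by_cases h1 : ∃! p, b p
  · simp [channel, h1] at h
  · simp [channel_of_not_existsUnique msg ⟨p, hp⟩ h1] at h

theorem exists_of_channel_eq_heard {b : ι → Prop} {msg : ι → M} {x : M}
    (h : channel b msg = .heard x) : ∃ p, b p ∧ msg p = x := by
  by_cases h1 : ∃! p, b p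
  · obtain ⟨p, hp, hu⟩ := h1
    rw [channel_of_unique msg hp hu] at h
    exact ⟨p, hp, by simpa using h⟩
  · by_cases h2 : ∃ p, b p
    · simp [channel_of_not_existsUnique msg h2 h1] at h
    · simp [channel_of_forall_not msg (not_exists.1 h2)] at h

end Channel

namespace RandSimple

/-! ### The common state of the stations -/

variable {n m : ℕ}

/-- An edge is waiting iff it can be added to the forest of revealed edges. -/
def IsWaiting (R : Finset (Sym2 (Fin n))) (e : Sym2 (Fin n)) : Prop :=
  e ∉ R ∧ IsForest (insert e R)

theorem IsWaiting.anti {R S : Finset (Sym2 (Fin n))} {e : Sym2 (Fin n)} (h : R ⊆ S)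
    (hS : IsWaiting S e) : IsWaiting R e :=
  ⟨fun he => hS.1 (h he), hS.2.anti (Finset.insert_subset_insert _ h)⟩

open Classical in
/-- The status of an edge, as determined by the set of revealed edges. -/
noncomputable def statusOf (R : Finset (Sym2 (Fin n))) (e : Sym2 (Fin n)) : Status :=
  if e ∈ R then .revealed else if IsForest (insert e R) then .waiting else .cycle

theorem statusOf_eq_waiting_iff {R : Finset (Sym2 (Fin n))} {e : Sym2 (Fin n)} :
    statusOf R e = .waiting ↔ IsWaiting R e := by
  unfold statusOf IsWaiting
  split_ifs <;> simp_all

theorem statusOf_eq_revealed_iff {R : Finset (Sym2 (Fin n))} {e : Sym2 (Fin n)} :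
    statusOf R e = .revealed ↔ e ∈ R := by
  unfold statusOf
  split_ifs <;> simp_all

/-- The part of the memory that all the stations share; `exp` is the exponent of `a = 3 ^ exp`. -/
@[ext]
structure Global (n : ℕ) : Type where
  label : Label
  exp : ℕ
  counter : ℕ
  revealed : Finset (Sym2 (Fin n))

/-- The memory of the station that holds `e`. -/
noncomputable def Global.view (g : Global n) (e : Sym2 (Fin n)) : Memory n where
  label := g.label
  a := 3 ^ g.exp
  counter := g.counter
  status := statusOf g.revealed e
  revealed := g.revealed

/-- The set of revealed edges after a feedback. -/
noncomputable def revealedAfter (R : Finset (Sym2 (Fin n))) :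
    Feedback (Msg n) → Finset (Sym2 (Fin n))
  | .heard (.edge e) => addRevealed R e
  | .heard .dummy => R
  | .noise => R
  | .silence => R

/-- The exponent of `a` after a feedback in step A. -/
def expAfter (j : ℕ) : Feedback (Msg n) → ℕ
  | .heard _ => j
  | .noise => j + 1
  | .silence => j - 1

/-- The common state after a feedback. -/
noncomputable def Global.next (g : Global n) (f : Feedback (Msg n)) : Global n :=
  match g.label with
  | .A => ⟨.C, expAfter g.exp f, g.counter + 1, revealedAfter g.revealed f⟩
  | .C => ⟨.D, g.exp, g.counter, revealedAfter g.revealed f⟩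
  | .D => ⟨afterD f, g.exp, g.counter, g.revealed⟩
  | .done => g

theorem subset_addRevealed (R : Finset (Sym2 (Fin n))) (e : Sym2 (Fin n)) :
    R ⊆ addRevealed R e := by
  unfold addRevealed
  split_ifs
  · exact Finset.subset_insert _ _
  · exact subset_rfl

theorem mem_addRevealed {R : Finset (Sym2 (Fin n))} {e e' : Sym2 (Fin n)}
    (h : e' ∈ addRevealed R e) : e' ∈ R ∨ e' = e := by
  unfold addRevealed at h
  split_ifs at h
  · exact (Finset.mem_insert.1 h).symm
  · exact .inl h

theorem addRevealed_of_isWaiting {R : Finset (Sym2 (Fin n))} {e : Sym2 (Fin n)}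
    (h : IsWaiting R e) : addRevealed R e = insert e R :=
  if_pos h.2

theorem not_isWaiting_addRevealed (R : Finset (Sym2 (Fin n))) (e : Sym2 (Fin n)) :
    ¬ IsWaiting (addRevealed R e) e := by
  unfold addRevealed
  split_ifs with h
  · exact fun h' => h'.1 (Finset.mem_insert_self _ _)
  · exact fun h' => h h'.2

theorem isForest_addRevealed {R : Finset (Sym2 (Fin n))} (hR : IsForest R) (e : Sym2 (Fin n)) :
    IsForest (addRevealed R e) := by
  unfold addRevealed
  split_ifs with h
  exacts [h, hR]

/-- This is why the status need not be part of the common state: the local update of a status agrees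
with recomputing it from the new revealed set. -/
theorem newStatus_statusOf (R : Finset (Sym2 (Fin n))) (own e : Sym2 (Fin n)) :
    newStatus own e (addRevealed R e) (statusOf R own) = statusOf (addRevealed R e) own := by
  have hsub := subset_addRevealed R e
  by_cases h1 : own ∈ R
  · rw [statusOf_eq_revealed_iff.2 h1, statusOf_eq_revealed_iff.2 (hsub h1), newStatus]
  by_cases h2 : IsForest (insert own R)
  · rw [statusOf_eq_waiting_iff.2 ⟨h1, h2⟩, newStatus]
    split_ifs with he h3
    · subst he
      rw [statusOf_eq_revealed_iff.2]
      rw [addRevealed, if_pos h2]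
      exact Finset.mem_insert_self _ _
    · have h4 : own ∉ addRevealed R e := fun h => (mem_addRevealed h).elim h1 fun h => he h.symm
      rw [statusOf_eq_waiting_iff.2 ⟨h4, h3⟩]
    · have h4 : own ∉ addRevealed R e := fun h => (mem_addRevealed h).elim h1 fun h => he h.symm
      simp [statusOf, h3, h4]
  -- A cycle edge stays one, since the revealed set only grows. Even when step C broadcasts it,
  -- `addRevealed` rejects it.
  · have h3 : ¬ IsForest (insert own (addRevealed R e)) :=
      fun h => h2 (h.anti (Finset.insert_subset_insert _ hsub))
    have h4 : own ∉ addRevealed R e := by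
      intro h
      rcases mem_addRevealed h with h | rfl
      · exact h1 h
      · rw [addRevealed, if_neg h2] at h
        exact h1 h
    simp [statusOf, h1, h2, h3, h4, newStatus]

theorem subset_revealedAfter (R : Finset (Sym2 (Fin n))) (f : Feedback (Msg n)) :
    R ⊆ revealedAfter R f := by
  rcases f with _ | (e | _) | _
  · exact subset_rfl
  · exact subset_addRevealed R e
  · exact subset_rfl
  · exact subset_rfl

theorem isForest_revealedAfter {R : Finset (Sym2 (Fin n))} (hR : IsForest R)
    (f : Feedback (Msg n)) : IsForest (revealedAfter R f) := by
  rcases f with _ | (e | _) | _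
  exacts [hR, isForest_addRevealed hR e, hR, hR]

theorem mem_revealedAfter {R : Finset (Sym2 (Fin n))} {e : Sym2 (Fin n)} {f : Feedback (Msg n)}
    (h : e ∈ revealedAfter R f) : e ∈ R ∨ f = .heard (.edge e) := by
  rcases f with _ | (e' | _) | _
  · exact .inl h
  · exact (mem_addRevealed h).imp id fun h => by rw [h]
  · exact .inl h
  · exact .inl h

/-- Truncated subtraction on exponents is exactly the cut-off of `a` at 1. -/
theorem max_pow_div_three (j : ℕ) : max ((3 : ℚ) ^ j / 3) 1 = 3 ^ (j - 1) := by
  cases j with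
  | zero => norm_num
  | succ j =>
    rw [pow_succ, mul_div_cancel_right₀ _ (by norm_num), Nat.add_sub_cancel]
    exact max_eq_left (one_le_pow₀ (by norm_num))

theorem next_view (i : Input n) (g : Global n) (f : Feedback (Msg n)) :
    next i (g.view i.edge) f = (g.next f).view i.edge := by
  obtain ⟨l, j, c, R⟩ := g
  rcases l with _ | _ | _ | _
  · rcases f with _ | (e | _) | _ <;>
      simp [next, Global.view, Global.next, afterA, hear, expAfter, revealedAfter,
        newStatus_statusOf, max_pow_div_three, pow_succ']
  · rcases f with _ | (e | _) | _ <;>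
      simp [next, Global.view, Global.next, afterC, hear, revealedAfter, newStatus_statusOf]
  · rfl
  · rfl

/-- The initial common state. -/
def Global.init (n : ℕ) : Global n := ⟨.A, 0, 0, ∅⟩

theorem view_init (e : Sym2 (Fin n)) : (Global.init n).view e = (algorithm n).init := by
  simp [Global.view, Global.init, algorithm, statusOf, isForest_singleton]

/-- The feedback in a common state. -/
noncomputable def globalFeedback (inp : Fin m → Input n) (x : Fin m → ℝ) (g : Global n) :
    Feedback (Msg n) :=
  (algorithm n).feedback inp x fun p => g.view (inp p).edge

/-- One step from a common state. -/
noncomputable def globalStep (inp : Fin m → Input n) (x : Fin m → ℝ) (g : Global n) : Global n :=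
  g.next (globalFeedback inp x g)

/-- The common state after `t` steps. -/
noncomputable def globalRun (inp : Fin m → Input n) (u : ℕ → Fin m → ℝ) : ℕ → Global n
  | 0 => Global.init n
  | t + 1 => globalStep inp (u t) (globalRun inp u t)

theorem step_view (inp : Fin m → Input n) (x : Fin m → ℝ) (g : Global n) :
    (algorithm n).step inp x (fun p => g.view (inp p).edge) =
      fun p => (globalStep inp x g).view (inp p).edge := by
  funext p
  unfold Protocol.step
  split_ifs with h
  · change g.label = .done at h
    simp [globalStep, Global.next, h]
  · exact next_view (inp p) g _

theorem run_eq_view (inp : Fin m → Input n) (u : ℕ → Fin m → ℝ) (t : ℕ) :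
    (algorithm n).run inp u t = fun p => (globalRun inp u t).view (inp p).edge := by
  induction t with
  | zero =>
    funext p
    exact (view_init _).symm
  | succ t ih => rw [Protocol.run, ih, step_view, globalRun]

theorem feedbackAt_eq (inp : Fin m → Input n) (u : ℕ → Fin m → ℝ) (t : ℕ) :
    (algorithm n).feedbackAt inp u t = globalFeedback inp (u t) (globalRun inp u t) := by
  rw [Protocol.feedbackAt, run_eq_view, globalFeedback]

theorem halted_run_iff (inp : Fin m → Input n) (u : ℕ → Fin m → ℝ) (t : ℕ) (p : Fin m) :
    (algorithm n).halted ((algorithm n).run inp u t p) ↔ (globalRun inp u t).label = .done := by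
  rw [run_eq_view]
  rfl

theorem subset_revealed_next (g : Global n) (f : Feedback (Msg n)) :
    g.revealed ⊆ (g.next f).revealed := by
  obtain ⟨l, j, c, R⟩ := g
  rcases l with _ | _ | _ | _
  exacts [subset_revealedAfter _ _, subset_revealedAfter _ _, subset_rfl, subset_rfl]

theorem mem_revealed_next {g : Global n} {f : Feedback (Msg n)} {e : Sym2 (Fin n)}
    (h : e ∈ (g.next f).revealed) : e ∈ g.revealed ∨ f = .heard (.edge e) := by
  obtain ⟨l, j, c, R⟩ := g
  rcases l with _ | _ | _ | _
  exacts [mem_revealedAfter h, mem_revealedAfter h, .inl h, .inl h]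

theorem isForest_revealed_next {g : Global n} (hg : IsForest g.revealed) (f : Feedback (Msg n)) :
    IsForest (g.next f).revealed := by
  obtain ⟨l, j, c, R⟩ := g
  rcases l with _ | _ | _ | _
  exacts [isForest_revealedAfter hg _, isForest_revealedAfter hg _, hg, hg]

theorem isForest_globalRun (inp : Fin m → Input n) (u : ℕ → Fin m → ℝ) (t : ℕ) :
    IsForest (globalRun inp u t).revealed := by
  induction t with
  | zero => exact isForest_empty
  | succ t ih => exact isForest_revealed_next ih _

theorem exists_feedbackAt_of_mem_revealed (inp : Fin m → Input n) (u : ℕ → Fin m → ℝ) {t : ℕ}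
    {e : Sym2 (Fin n)} (h : e ∈ (globalRun inp u t).revealed) :
    ∃ s < t, (algorithm n).feedbackAt inp u s = .heard (.edge e) := by
  induction t with
  | zero => simp [globalRun, Global.init] at h
  | succ t ih =>
    rcases mem_revealed_next h with h | h
    · obtain ⟨s, hs, he⟩ := ih h
      exact ⟨s, by omega, he⟩
    · exact ⟨t, by omega, by rw [feedbackAt_eq, h]⟩

/-! ### Broadcasts in a common state -/

/-- Station `p` broadcasts in the common state `g`. -/
def GlobalBroadcasts (inp : Fin m → Input n) (x : Fin m → ℝ) (g : Global n) (p : Fin m) : Prop :=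
  (algorithm n).Broadcasts inp x (fun p => g.view (inp p).edge) p

theorem globalFeedback_eq_channel (inp : Fin m → Input n) (x : Fin m → ℝ) (g : Global n) :
    globalFeedback inp x g = channel (GlobalBroadcasts inp x g)
      fun p => msg (inp p) (g.view (inp p).edge) := rfl

variable {inp : Fin m → Input n} {x : Fin m → ℝ} {g : Global n} {p : Fin m}

theorem broadcasts_of_label_A (hx : ∀ p, x p ∈ Set.Ico (0 : ℝ) 1) (hl : g.label = .A) :
    GlobalBroadcasts inp x g p ↔
      IsWaiting g.revealed (inp p).edge ∧ x p < ((3 : ℝ) ^ g.exp)⁻¹ := by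
  -- The range `[0,1)` makes the extreme trials deterministic: `0 ≤ x p` forbids success at
  -- probability 0, and in steps C and D `x p < 1` forces it at probability 1.
  have h0 := (hx p).1
  simp only [GlobalBroadcasts, Protocol.Broadcasts, algorithm, prob, Global.view, hl,
    ← statusOf_eq_waiting_iff]
  split_ifs with h <;> simp [h, h0.not_gt]

theorem broadcasts_of_label_C (hx : ∀ p, x p ∈ Set.Ico (0 : ℝ) 1) (hl : g.label = .C) :
    GlobalBroadcasts inp x g p ↔ (inp p).id = g.counter := by
  have h0 := (hx p).1
  have h1 := (hx p).2
  simp only [GlobalBroadcasts, Protocol.Broadcasts, algorithm, prob, Global.view, hl]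
  split_ifs with h <;> simp [h, h0.not_gt, h1]

theorem broadcasts_of_label_D (hx : ∀ p, x p ∈ Set.Ico (0 : ℝ) 1) (hl : g.label = .D) :
    GlobalBroadcasts inp x g p ↔ IsWaiting g.revealed (inp p).edge := by
  have h0 := (hx p).1
  have h1 := (hx p).2
  simp only [GlobalBroadcasts, Protocol.Broadcasts, algorithm, prob, Global.view, hl,
    ← statusOf_eq_waiting_iff]
  split_ifs with h <;> simp [h, h0.not_gt, h1]

end RandSimple

/-! ### Running time -/

theorem iInf_natCast_eq_find {P : ℕ → Prop} [DecidablePred P] (h : ∃ k, P k) :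
    ⨅ (k : ℕ) (_ : P k), (k : ℕ∞) = (Nat.find h : ℕ∞) :=
  le_antisymm (iInf₂_le _ (Nat.find_spec h))
    (le_iInf₂ fun _ hk => Nat.cast_le.2 (Nat.find_min' h hk))

open Classical in
/-- The first time at which a persistent event occurs counts the times before it occurs. -/
theorem iInf_natCast_eq_tsum {P : ℕ → Prop} (hP : ∀ t, P t → P (t + 1)) :
    ((⨅ (k : ℕ) (_ : P k), (k : ℕ∞) : ℕ∞) : ℝ≥0∞) = ∑' t, if P t then 0 else 1 := by
  by_cases h : ∃ k, P k
  · rw [iInf_natCast_eq_find h, tsum_eq_sum (s := Finset.range (Nat.find h))]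
    · rw [Finset.sum_congr rfl fun t ht => if_neg (Nat.find_min h (Finset.mem_range.1 ht))]
      simp
    · intro t ht
      refine if_pos ?_
      rw [Finset.mem_range, not_lt] at ht
      exact Nat.le_induction (Nat.find_spec h) (fun t _ => hP t) t ht
  · rw [not_exists] at h
    simp [h]

namespace RandSimple

variable {n m : ℕ}

theorem label_globalRun_succ_of_done {inp : Fin m → Input n} {u : ℕ → Fin m → ℝ} {t : ℕ}
    (h : (globalRun inp u t).label = .done) : (globalRun inp u (t + 1)).label = .done := by
  rw [globalRun, globalStep, Global.next, h]
  exact h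

/-! ### Invariants of the execution -/

variable {G : SimpleGraph (Fin n)} (edge : Fin m ≃ G.edgeSet)

/-- What is true of the common state whenever there is a station. -/
structure Invariant (g : Global n) : Prop where
  subset : (g.revealed : Set (Sym2 (Fin n))) ⊆ G.edgeSet
  isForest : IsForest g.revealed
  exists_isWaiting : g.label = .A → ∃ p, IsWaiting g.revealed (edge p : Sym2 (Fin n))
  not_isWaiting : g.label = .done → ∀ p, ¬ IsWaiting g.revealed (edge p : Sym2 (Fin n))

variable {edge} {x : Fin m → ℝ} {g : Global n}

theorem mem_edgeSet_of_globalFeedback_eq {inp : Fin m → Input n} {e : Sym2 (Fin n)}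
    (h : globalFeedback inp x g = .heard (.edge e)) : ∃ p, (inp p).edge = e := by
  rw [globalFeedback_eq_channel] at h
  obtain ⟨p, -, hp⟩ := exists_of_channel_eq_heard h
  refine ⟨p, ?_⟩
  obtain ⟨l, j, c, R⟩ := g
  rcases l with _ | _ | _ | _ <;> simp_all [msg, Global.view]

theorem subset_edgeSet_globalStep (h : (g.revealed : Set (Sym2 (Fin n))) ⊆ G.edgeSet) :
    ((globalStep (input edge) x g).revealed : Set (Sym2 (Fin n))) ⊆ G.edgeSet := by
  intro e he
  rcases mem_revealed_next he with he | he
  · exact h he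
  · obtain ⟨p, rfl⟩ := mem_edgeSet_of_globalFeedback_eq he
    exact (edge p).2

/-- A station is needed: without edges the initial label is still `A`, although nothing is waiting.
-/
theorem invariant_init (p : Fin m) : Invariant edge (Global.init n) where
  subset := by simp [Global.init]
  isForest := isForest_empty
  exists_isWaiting _ := ⟨p, by simp [Global.init, IsWaiting, isForest_singleton]⟩
  not_isWaiting h := by simp [Global.init] at h

theorem globalFeedback_eq_silence_iff_of_label_D (hx : ∀ p, x p ∈ Set.Ico (0 : ℝ) 1)
    (hl : g.label = .D) : globalFeedback (input edge) x g = .silence ↔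
      ∀ p, ¬ IsWaiting g.revealed (edge p : Sym2 (Fin n)) := by
  rw [globalFeedback_eq_channel, channel_eq_silence_iff]
  simp only [broadcasts_of_label_D hx hl]
  rfl

theorem afterD_of_ne_silence {f : Feedback (Msg n)} (hf : f ≠ .silence) : afterD f = .A := by
  rcases f with _ | _ | _
  exacts [absurd rfl hf, rfl, rfl]

theorem globalStep_of_label_D_of_forall (hx : ∀ p, x p ∈ Set.Ico (0 : ℝ) 1)
    (hl : g.label = .D) (h : ∀ p, ¬ IsWaiting g.revealed (edge p : Sym2 (Fin n))) :
    globalStep (input edge) x g = ⟨.done, g.exp, g.counter, g.revealed⟩ := by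
  rw [globalStep, Global.next, hl, (globalFeedback_eq_silence_iff_of_label_D hx hl).2 h]
  rfl

theorem globalStep_of_label_D_of_exists (hx : ∀ p, x p ∈ Set.Ico (0 : ℝ) 1)
    (hl : g.label = .D) (h : ∃ p, IsWaiting g.revealed (edge p : Sym2 (Fin n))) :
    globalStep (input edge) x g = ⟨.A, g.exp, g.counter, g.revealed⟩ := by
  rw [globalStep, Global.next, hl]
  dsimp only
  rw [afterD_of_ne_silence]
  rw [Ne, globalFeedback_eq_silence_iff_of_label_D hx hl]
  push Not
  exact h

theorem Invariant.globalStep (hg : Invariant edge g) (hx : ∀ p, x p ∈ Set.Ico (0 : ℝ) 1) :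
    Invariant edge (globalStep (input edge) x g) := by
  have h1 := subset_edgeSet_globalStep (edge := edge) (x := x) hg.subset
  have h2 : IsForest (RandSimple.globalStep (input edge) x g).revealed :=
    isForest_revealed_next hg.isForest _
  rcases hl : g.label with _ | _ | _ | _
  · refine ⟨h1, h2, fun h => ?_, fun h => ?_⟩ <;>
      simp [RandSimple.globalStep, Global.next, hl] at h
  · refine ⟨h1, h2, fun h => ?_, fun h => ?_⟩ <;>
      simp [RandSimple.globalStep, Global.next, hl] at h
  · by_cases h : ∃ p, IsWaiting g.revealed (edge p : Sym2 (Fin n))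
    · rw [globalStep_of_label_D_of_exists hx hl h]
      exact ⟨hg.subset, hg.isForest, fun _ => h, by simp⟩
    · rw [not_exists] at h
      rw [globalStep_of_label_D_of_forall hx hl h]
      exact ⟨hg.subset, hg.isForest, by simp, fun _ => h⟩
  · simpa [RandSimple.globalStep, Global.next, hl] using hg

theorem globalFeedback_of_label_C (hx : ∀ p, x p ∈ Set.Ico (0 : ℝ) 1) (hl : g.label = .C)
    {p : Fin m} (hp : (p : ℕ) + 1 = g.counter) :
    globalFeedback (input edge) x g = .heard (.edge (edge p)) := by
  rw [globalFeedback_eq_channel, channel_of_unique (p := p)]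
  · simp [msg, Global.view, hl, input]
  · rw [broadcasts_of_label_C hx hl]
    exact hp
  · intro q hq
    rw [broadcasts_of_label_C hx hl] at hq
    exact Fin.ext (by simp only [input] at hq; omega)

/-- How far the execution has come after `t` steps. -/
structure Progress (edge : Fin m ≃ G.edgeSet) (t : ℕ) (g : Global n) : Prop where
  time_A : g.label = .A → t = 3 * g.counter
  time_C : g.label = .C → t + 2 = 3 * g.counter
  time_D : g.label = .D → t + 1 = 3 * g.counter
  -- The counter is increased in step A, so while step C is pending the station whose turn it is
  -- must be exempted.
  not_isWaiting : ∀ p : Fin m, (p : ℕ) + 1 ≤ g.counter → ((p : ℕ) + 1 = g.counter → g.label ≠ .C) →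
    ¬ IsWaiting g.revealed (edge p : Sym2 (Fin n))

theorem progress_init : Progress edge 0 (Global.init n) := by
  constructor <;> simp [Global.init]

theorem Progress.globalStep {t : ℕ} (hg : Progress edge t g)
    (hx : ∀ p, x p ∈ Set.Ico (0 : ℝ) 1) :
    Progress edge (t + 1) (globalStep (input edge) x g) := by
  have hsub : g.revealed ⊆ (RandSimple.globalStep (input edge) x g).revealed :=
    subset_revealed_next _ _
  rcases hl : g.label with _ | _ | _ | _
  · have ht := hg.time_A hl
    have hc : (RandSimple.globalStep (input edge) x g).counter = g.counter + 1 := by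
      simp [RandSimple.globalStep, Global.next, hl]
    have hl' : (RandSimple.globalStep (input edge) x g).label = .C := by
      simp [RandSimple.globalStep, Global.next, hl]
    refine ⟨by simp [hl'], fun _ => by omega, by simp [hl'], fun p hp hp' hw => ?_⟩
    rw [hl', hc] at hp'
    exact hg.not_isWaiting p (by by_contra; exact hp' (by omega) rfl) (by simp [hl])
      (hw.anti hsub)
  · have ht := hg.time_C hl
    have hc : (RandSimple.globalStep (input edge) x g).counter = g.counter := by
      simp [RandSimple.globalStep, Global.next, hl]
    have hl' : (RandSimple.globalStep (input edge) x g).label = .D := by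
      simp [RandSimple.globalStep, Global.next, hl]
    refine ⟨by simp [hl'], by simp [hl'], fun _ => by omega, fun p hp _ hw => ?_⟩
    rw [hc] at hp
    by_cases hp' : (p : ℕ) + 1 = g.counter
    · rw [RandSimple.globalStep, globalFeedback_of_label_C hx hl hp', Global.next, hl] at hw
      exact not_isWaiting_addRevealed _ _ hw
    · exact hg.not_isWaiting p hp (fun h => absurd h hp') (hw.anti hsub)
  · have ht := hg.time_D hl
    have hw : ∀ p : Fin m, (p : ℕ) + 1 ≤ g.counter →
        ¬ IsWaiting g.revealed (edge p : Sym2 (Fin n)) :=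
      fun p hp => hg.not_isWaiting p hp (by simp [hl])
    by_cases h : ∃ p, IsWaiting g.revealed (edge p : Sym2 (Fin n))
    · rw [globalStep_of_label_D_of_exists hx hl h]
      exact ⟨fun _ => by omega, by simp, by simp, fun p hp _ => hw p hp⟩
    · rw [not_exists] at h
      rw [globalStep_of_label_D_of_forall hx hl h]
      exact ⟨by simp, by simp, by simp, fun p hp _ => hw p hp⟩
  · have : RandSimple.globalStep (input edge) x g = g := by
      simp [RandSimple.globalStep, Global.next, hl]
    rw [this]
    exact ⟨by simp [hl], by simp [hl], by simp [hl], hg.not_isWaiting⟩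

/-! ### Termination and correctness of every execution -/

variable {u : ℕ → Fin m → ℝ}

theorem invariant_globalRun (p : Fin m) (hu : ∀ t p, u t p ∈ Set.Ico (0 : ℝ) 1) (t : ℕ) :
    Invariant edge (globalRun (input edge) u t) := by
  induction t with
  | zero => exact invariant_init p
  | succ t ih => exact ih.globalStep (hu t)

theorem progress_globalRun (hu : ∀ t p, u t p ∈ Set.Ico (0 : ℝ) 1) (t : ℕ) :
    Progress edge t (globalRun (input edge) u t) := by
  induction t with
  | zero => exact progress_init
  | succ t ih => exact ih.globalStep (hu t)

theorem label_globalRun_eq_done (p : Fin m) (hu : ∀ t p, u t p ∈ Set.Ico (0 : ℝ) 1) :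
    (globalRun (input edge) u (3 * m)).label = .done := by
  have hI := invariant_globalRun (edge := edge) p hu (3 * m)
  have hP := progress_globalRun (edge := edge) hu (3 * m)
  rcases hl : (globalRun (input edge) u (3 * m)).label with _ | _ | _ | _
  -- At label `A` the counter is `m`, so every station has had its turn and nothing can be waiting.
  -- The labels `C` and `D` are impossible modulo 3.
  · obtain ⟨q, hq⟩ := hI.exists_isWaiting hl
    have := hP.time_A hl
    exact absurd hq (hP.not_isWaiting q (by omega) (by simp [hl]))
  · have := hP.time_C hl
    omega
  · have := hP.time_D hl
    omega
  · rfl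

theorem isSpanningForest_of_forall_not_isWaiting {R : Finset (Sym2 (Fin n))}
    (hsub : (R : Set (Sym2 (Fin n))) ⊆ G.edgeSet) (hR : IsForest R)
    (h : ∀ p, ¬ IsWaiting R (edge p : Sym2 (Fin n))) : IsSpanningForest G R := by
  refine ⟨hsub, hR, fun e he heR hf => h (edge.symm ⟨e, he⟩) ?_⟩
  rw [Equiv.apply_symm_apply]
  exact ⟨heR, hf⟩

variable (edge)

theorem exists_halted (hu : ∀ t p, u t p ∈ Set.Ico (0 : ℝ) 1) :
    ∀ p, (algorithm n).halted ((algorithm n).run (input edge) u (3 * m) p) := by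
  intro p
  rw [halted_run_iff]
  exact label_globalRun_eq_done p hu

theorem isSpanningForest_of_halted (hu : ∀ t p, u t p ∈ Set.Ico (0 : ℝ) 1) {k : ℕ}
    (hk : ∀ p, (algorithm n).halted ((algorithm n).run (input edge) u k p)) :
    IsSpanningForest G (globalRun (input edge) u k).revealed := by
  refine isSpanningForest_of_forall_not_isWaiting (edge := edge) ?_
    (isForest_globalRun _ _ _) fun p => ?_
  -- `Invariant` presupposes a station, so the inclusion is derived from the channel instead, which
  -- also covers `m = 0`.
  · intro e he
    obtain ⟨s, -, hs⟩ := exists_feedbackAt_of_mem_revealed _ _ he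
    rw [feedbackAt_eq] at hs
    obtain ⟨p, rfl⟩ := mem_edgeSet_of_globalFeedback_eq hs
    exact (edge p).2
  · exact (invariant_globalRun p hu k).not_isWaiting ((halted_run_iff _ _ _ _).1 (hk p)) p

theorem exists_time_eq (hu : ∀ t p, u t p ∈ Set.Ico (0 : ℝ) 1) :
    ∃ k : ℕ, (algorithm n).time (input edge) u = (k : ℕ∞) ∧ k ≤ 3 * m ∧
      ∃ T : Finset (Sym2 (Fin n)), IsSpanningForest G T ∧
        (∀ e ∈ T, ∃ t < k, (algorithm n).feedbackAt (input edge) u t = .heard (.edge e)) ∧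
        ∀ p : Fin m, ((algorithm n).run (input edge) u k p).revealed = T ∧
          (((algorithm n).run (input edge) u k p).status = .revealed ↔
            (edge p : Sym2 (Fin n)) ∈ T) := by
  classical
  have hex : ∃ k, ∀ p, (algorithm n).halted ((algorithm n).run (input edge) u k p) :=
    ⟨_, exists_halted edge hu⟩
  refine ⟨Nat.find hex, iInf_natCast_eq_find hex, Nat.find_min' hex (exists_halted edge hu),
    (globalRun (input edge) u (Nat.find hex)).revealed,
    isSpanningForest_of_halted edge hu (Nat.find_spec hex),
    fun e he => exists_feedbackAt_of_mem_revealed _ _ he, fun p => ?_⟩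
  rw [run_eq_view]
  exact ⟨rfl, statusOf_eq_revealed_iff⟩

theorem card_le_time (hu : ∀ t p, u t p ∈ Set.Ico (0 : ℝ) 1) {T : Finset (Sym2 (Fin n))}
    (hT : IsSpanningForest G T) : (T.card : ℕ∞) ≤ (algorithm n).time (input edge) u := by
  obtain ⟨k, hk, -, S, hS, hheard, -⟩ := exists_time_eq edge hu
  rw [hk, Nat.cast_le, hT.card_eq hS, ← Finset.card_range k]
  -- The steps in which distinct edges are heard are distinct, as a feedback carries a single edge.
  choose! t ht using hheard
  refine Finset.card_le_card_of_injOn t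
    (fun e he => Finset.mem_coe.2 (Finset.mem_range.2 (ht e he).1)) ?_
  intro e he e' he' h
  have := (ht e he).2.symm.trans (h ▸ (ht e' he').2)
  simpa using this

end RandSimple

/-! ### Independent uniform trials -/

/-- The uniform distribution on `[0,1)`. -/
noncomputable def uniformUnit : Measure ℝ := cond volume (Set.Ico (0 : ℝ) 1)

instance : IsProbabilityMeasure uniformUnit :=
  cond_isProbabilityMeasure_of_finite (by simp) (by simp)

theorem uniformUnit_apply (s : Set ℝ) :
    uniformUnit s = volume (Set.Ico (0 : ℝ) 1 ∩ s) := by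
  rw [uniformUnit, cond_apply measurableSet_Ico]
  simp

theorem uniformUnit_Iio {q : ℝ} (h1 : q ≤ 1) : uniformUnit (Set.Iio q) = ENNReal.ofReal q := by
  rw [uniformUnit_apply]
  have : Set.Ico (0 : ℝ) 1 ∩ Set.Iio q = Set.Ico 0 q := by
    ext y
    simp only [Set.mem_inter_iff, Set.mem_Ico, Set.mem_Iio]
    exact ⟨fun h => ⟨h.1.1, h.2⟩, fun h => ⟨⟨h.1, h.2.trans_le h1⟩, h.2⟩⟩
  rw [this, Real.volume_Ico, sub_zero]

theorem uniformUnit_Ici {q : ℝ} (h0 : 0 ≤ q) :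
    uniformUnit (Set.Ici q) = ENNReal.ofReal (1 - q) := by
  rw [uniformUnit_apply]
  have : Set.Ico (0 : ℝ) 1 ∩ Set.Ici q = Set.Ico q 1 := by
    ext y
    simp only [Set.mem_inter_iff, Set.mem_Ico, Set.mem_Ici]
    exact ⟨fun h => ⟨h.2, h.1.2⟩, fun h => ⟨⟨h0.trans h.1, h.2⟩, h.1⟩⟩
  rw [this, Real.volume_Ico]

theorem ae_uniformUnit : ∀ᵐ y ∂uniformUnit, y ∈ Set.Ico (0 : ℝ) 1 :=
  ae_cond_mem measurableSet_Ico

section Trials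

variable {ι : Type} [Fintype ι]

/-- The distribution of the trials of all the stations in one step. -/
noncomputable def trials (ι : Type) [Fintype ι] : Measure (ι → ℝ) :=
  Measure.pi fun _ => uniformUnit

instance : IsProbabilityMeasure (trials ι) := by
  unfold trials
  infer_instance

theorem ae_trials : ∀ᵐ x ∂trials ι, ∀ p, x p ∈ Set.Ico (0 : ℝ) 1 :=
  ae_all_iff.2 fun p =>
    (measurePreserving_eval (fun _ : ι => uniformUnit) p).quasiMeasurePreserving.ae ae_uniformUnit

/-- No station of `W` succeeds in its trial. -/
def noSuccess (W : Finset ι) (q : ℝ) : Set (ι → ℝ) := {x | ∀ p ∈ W, q ≤ x p}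

/-- The station `p` is the only one of `W` that succeeds in its trial. -/
def onlySuccess (W : Finset ι) (q : ℝ) (p : ι) : Set (ι → ℝ) :=
  {x | x p < q ∧ ∀ p' ∈ W, p' ≠ p → q ≤ x p'}

theorem measurableSet_noSuccess (W : Finset ι) (q : ℝ) : MeasurableSet (noSuccess W q) := by
  unfold noSuccess
  measurability

theorem measurableSet_onlySuccess (W : Finset ι) (q : ℝ) (p : ι) :
    MeasurableSet (onlySuccess W q p) := by
  unfold onlySuccess
  measurability

theorem trials_noSuccess (W : Finset ι) {q : ℝ} (h0 : 0 ≤ q) (h1 : q ≤ 1) :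
    trials ι (noSuccess W q) = ENNReal.ofReal ((1 - q) ^ W.card) := by
  classical
  have : noSuccess W q = Set.univ.pi fun p => if p ∈ W then Set.Ici q else Set.univ := by
    ext x
    simp only [noSuccess, Set.mem_ofPred_eq, Set.mem_univ_pi]
    refine forall_congr' fun p => ?_
    split_ifs with h <;> simp [h]
  rw [this, trials, Measure.pi_pi]
  simp_rw [apply_ite uniformUnit, measure_univ, uniformUnit_Ici h0]
  rw [Finset.prod_ite_mem, Finset.univ_inter, Finset.prod_const,
    ENNReal.ofReal_pow (by linarith)]

theorem trials_onlySuccess {W : Finset ι} {q : ℝ} (h0 : 0 ≤ q) (h1 : q ≤ 1) {p : ι} (hp : p ∈ W) :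
    trials ι (onlySuccess W q p) = ENNReal.ofReal (q * (1 - q) ^ (W.card - 1)) := by
  classical
  have : onlySuccess W q p = Set.univ.pi fun p' =>
      if p' = p then Set.Iio q else if p' ∈ W then Set.Ici q else Set.univ := by
    ext x
    simp only [onlySuccess, Set.mem_ofPred_eq, Set.mem_univ_pi]
    constructor
    · rintro ⟨h2, h3⟩ p'
      split_ifs with h4 h5
      · exact h4 ▸ h2
      · exact h3 p' h5 h4
      · trivial
    · intro h
      refine ⟨by simpa using h p, fun p' h4 h5 => by simpa [h4, h5] using h p'⟩
  rw [this, trials, Measure.pi_pi, ← Finset.mul_prod_erase _ _ (Finset.mem_univ p), if_pos rfl,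
    uniformUnit_Iio h1]
  have : ∀ p' ∈ Finset.univ.erase p, uniformUnit
      (if p' = p then Set.Iio q else if p' ∈ W then Set.Ici q else Set.univ) =
      if p' ∈ W then ENNReal.ofReal (1 - q) else 1 := by
    intro p' hp'
    rw [if_neg (Finset.ne_of_mem_erase hp'), apply_ite uniformUnit, measure_univ,
      uniformUnit_Ici h0]
  rw [Finset.prod_congr rfl this, Finset.prod_ite_mem, Finset.prod_const, Finset.erase_inter,
    Finset.univ_inter, Finset.card_erase_of_mem hp, ENNReal.ofReal_mul h0,
    ENNReal.ofReal_pow (by linarith)]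

/-- Exactly one station of `W` succeeds in its trial. -/
def oneSuccess (W : Finset ι) (q : ℝ) : Set (ι → ℝ) := ⋃ p ∈ W, onlySuccess W q p

theorem measurableSet_oneSuccess (W : Finset ι) (q : ℝ) : MeasurableSet (oneSuccess W q) :=
  Finset.measurableSet_biUnion _ fun p _ => measurableSet_onlySuccess W q p

theorem trials_oneSuccess (W : Finset ι) {q : ℝ} (h0 : 0 ≤ q) (h1 : q ≤ 1) :
    trials ι (oneSuccess W q) = ENNReal.ofReal (W.card * (q * (1 - q) ^ (W.card - 1))) := by
  rw [oneSuccess, measure_biUnion_finset]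
  · rw [Finset.sum_congr rfl fun p hp => trials_onlySuccess h0 h1 hp, Finset.sum_const,
      nsmul_eq_mul, ENNReal.ofReal_mul (Nat.cast_nonneg _), ENNReal.ofReal_natCast]
  · intro p hp p' hp' hne
    refine Set.disjoint_left.2 fun x hx hx' => ?_
    exact (hx.2 p' hp' hne.symm).not_gt hx'.1
  · exact fun p _ => measurableSet_onlySuccess W q p

theorem disjoint_noSuccess_oneSuccess {κ : Type} (W : Finset κ) (q : ℝ) :
    Disjoint (noSuccess W q) (oneSuccess W q) := by
  refine Set.disjoint_left.2 fun x hx hx' => ?_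
  simp only [oneSuccess, Set.mem_iUnion] at hx'
  obtain ⟨p, hp, hx'⟩ := hx'
  exact (hx p hp).not_gt hx'.1

/-- A bound on the mean of a function of the trials whose values are bounded according to whether
there is no success, exactly one, or more. -/
theorem lintegral_trials_le (W : Finset ι) {q : ℝ} (h0 : 0 ≤ q) (h1 : q ≤ 1)
    {f : (ι → ℝ) → ℝ≥0∞} {a b c d : ℝ} (ha : 0 ≤ a) (hb : 0 ≤ b) (hc : 0 ≤ c)
    (hfa : ∀ᵐ x ∂trials ι, x ∈ noSuccess W q → f x ≤ ENNReal.ofReal a)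
    (hfb : ∀ᵐ x ∂trials ι, x ∈ oneSuccess W q → f x ≤ ENNReal.ofReal b)
    (hfc : ∀ᵐ x ∂trials ι, x ∉ noSuccess W q → x ∉ oneSuccess W q → f x ≤ ENNReal.ofReal c)
    (hd : (1 - q) ^ W.card * a + W.card * (q * (1 - q) ^ (W.card - 1)) * b +
      (1 - (1 - q) ^ W.card - W.card * (q * (1 - q) ^ (W.card - 1))) * c + 1 ≤ d) :
    ∫⁻ x, f x ∂trials ι + 1 ≤ ENNReal.ofReal d := by
  set z := (1 - q) ^ W.card
  set s := W.card * (q * (1 - q) ^ (W.card - 1))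
  have hq : 0 ≤ 1 - q := by linarith
  have hz : 0 ≤ z := by positivity
  have hs : 0 ≤ s := by positivity
  have hS0 := measurableSet_noSuccess W q
  have hS1 := measurableSet_oneSuccess W q
  have hU : trials ι (noSuccess W q ∪ oneSuccess W q) = ENNReal.ofReal (z + s) := by
    rw [measure_union (disjoint_noSuccess_oneSuccess W q) hS1, trials_noSuccess W h0 h1,
      trials_oneSuccess W h0 h1, ENNReal.ofReal_add hz hs]
  have hzs : z + s ≤ 1 := by
    have := prob_le_one (μ := trials ι) (s := noSuccess W q ∪ oneSuccess W q)
    rwa [hU, ENNReal.ofReal_le_one] at this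
  have hN : trials ι (noSuccess W q ∪ oneSuccess W q)ᶜ = ENNReal.ofReal (1 - z - s) := by
    rw [prob_compl_eq_one_sub (hS0.union hS1), hU, sub_sub, ENNReal.ofReal_sub _ (by positivity),
      ENNReal.ofReal_one]
  have hE : ∫⁻ x, f x ∂trials ι ≤ ENNReal.ofReal (z * a + s * b + (1 - z - s) * c) := calc
    ∫⁻ x, f x ∂trials ι
      -- The three events partition the space, so only one of the indicators is nonzero at each
      -- point.
      ≤ ∫⁻ x, ((noSuccess W q).indicator (fun _ => ENNReal.ofReal a) x +
          (oneSuccess W q).indicator (fun _ => ENNReal.ofReal b) x) +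
          (noSuccess W q ∪ oneSuccess W q)ᶜ.indicator (fun _ => ENNReal.ofReal c) x
            ∂trials ι := by
        refine lintegral_mono_ae ?_
        filter_upwards [hfa, hfb, hfc] with x ha hb hc
        by_cases hx0 : x ∈ noSuccess W q
        · refine (ha hx0).trans (le_add_right (le_add_right ?_))
          simp [hx0]
        by_cases hx1 : x ∈ oneSuccess W q
        · refine (hb hx1).trans (le_add_right (le_add_left ?_))
          simp [hx1]
        · refine (hc hx0 hx1).trans (le_add_left ?_)
          simp [hx0, hx1]
    _ = _ := by
        rw [lintegral_add_right _ (measurable_const.indicator (hS0.union hS1).compl),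
          lintegral_add_right _ (measurable_const.indicator hS1),
          lintegral_indicator_const hS0, lintegral_indicator_const hS1,
          lintegral_indicator_const (hS0.union hS1).compl, hN, trials_noSuccess W h0 h1,
          trials_oneSuccess W h0 h1, ← ENNReal.ofReal_mul ha, ← ENNReal.ofReal_mul hb,
          ← ENNReal.ofReal_mul hc, ← ENNReal.ofReal_add (by positivity) (by positivity),
          ← ENNReal.ofReal_add (by positivity) (mul_nonneg hc (by linarith))]
        congr 1
        ring
  have h3 : 0 ≤ (1 - z - s) * c := mul_nonneg (by linarith) hc
  calc ∫⁻ x, f x ∂trials ι + 1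
      ≤ ENNReal.ofReal (z * a + s * b + (1 - z - s) * c) + ENNReal.ofReal 1 := by
        rw [ENNReal.ofReal_one]
        gcongr
    _ = ENNReal.ofReal (z * a + s * b + (1 - z - s) * c + 1) :=
        (ENNReal.ofReal_add (by positivity) zero_le_one).symm
    _ ≤ ENNReal.ofReal d := ENNReal.ofReal_le_ofReal hd

end Trials

/-! ### The drift of the backoff -/

/-- The potential of the backoff with `w` waiting stations at `a = 3 ^ j`. -/
def backoffPotential (w j : ℕ) : ℕ := j + 2 * (Nat.clog 3 (2 * w) - j)

/-- With truncated subtraction the potential is `L + |j - L|`. The distance `|j - L|` alone would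
not be monotone in the number of waiting stations; the additional `L` repairs this, so that removing
waiting edges is never harmful. -/
theorem backoffPotential_mono {v w : ℕ} (h : v ≤ w) (j : ℕ) :
    backoffPotential v j ≤ backoffPotential w j := by
  have := Nat.clog_mono_right 3 (show 2 * v ≤ 2 * w by omega)
  unfold backoffPotential
  omega

/-- Here `z`, `s` and `1 - z - s` are the probabilities of silence, success and noise. The expected
change is `2z - 14s - 1` for `0 < j < L`, `1 - 16s` at `j = L`, and `2(1 - z - s) - 14s - 1` for `j
> L`. The middle case dictates the reward 15, since the estimates give `s ≥ 1/8` there. -/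
theorem backoff_drift {w : ℕ} (hw : 1 ≤ w) (j : ℕ) {q z s : ℝ} (hq : q = ((3 : ℝ) ^ j)⁻¹)
    (hz : z = (1 - q) ^ w) (hs : s = w * (q * (1 - q) ^ (w - 1))) :
    z * backoffPotential w (j - 1) + s * (backoffPotential w j - 15) +
      (1 - z - s) * backoffPotential w (j + 1) + 1 ≤ backoffPotential w j := by
  have hq0 : 0 < q := by rw [hq]; positivity
  have hq1 : q ≤ 1 := by rw [hq]; exact inv_le_one_of_one_le₀ (one_le_pow₀ (by norm_num))
  have hqj : q * 3 ^ j = 1 := by rw [hq]; exact inv_mul_cancel₀ (by positivity)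
  have hw' : (1 : ℝ) ≤ w := by exact_mod_cast hw
  have hp0 : 0 ≤ (1 - q) ^ (w - 1) := pow_nonneg (by linarith) _
  have hs0 : 0 ≤ s := by rw [hs]; positivity
  have hzp : z = (1 - q) * (1 - q) ^ (w - 1) := by
    rw [hz, ← pow_succ', Nat.sub_add_cancel hw]
  have hz0 : 0 ≤ z := by rw [hz]; exact pow_nonneg (by linarith) _
  set L := Nat.clog 3 (2 * w) with hL
  have hL1 : 1 ≤ L := Nat.clog_pos (by norm_num) (by omega)
  have hzs : (1 : ℝ) ≤ 6 * (w * q) → z ≤ 6 * s := by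
    intro h
    rw [hzp, hs]
    -- With `b = (1 - q) ^ (w - 1)`: `z ≤ b` and `s = w q b`.
    nlinarith [mul_le_mul_of_nonneg_right h hp0]
  have hnear : j ≤ L → (1 : ℝ) ≤ 6 * (w * q) := by
    intro h
    rcases j with _ | j
    · rw [pow_zero, mul_one] at hqj
      rw [hqj]
      linarith
    -- Minimality of the ceiling logarithm: the preceding power of 3 is still below `2w`.
    · have h1 : 3 ^ j < 2 * w := (Nat.lt_clog_iff_pow_lt (by norm_num)).1 (by omega)
      have h2 : (3 : ℝ) ^ j < 2 * w := by exact_mod_cast h1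
      rw [pow_succ] at hqj
      nlinarith
  rcases lt_or_ge j L with hj | hj
  · have hzs := hzs (hnear hj.le)
    have hP : (backoffPotential w (j + 1) : ℝ) = backoffPotential w j - 1 := by
      rw [eq_sub_iff_add_eq]
      norm_cast
      simp only [backoffPotential, ← hL]
      omega
    rcases Nat.eq_zero_or_pos j with rfl | hj0
    -- At `a = 1` every waiting station broadcasts, so silence, which could not lower the exponent,
    -- does not occur.
    · have hz0 : z = 0 := by
        rw [pow_zero, mul_one] at hqj
        rw [hz, hqj, sub_self, zero_pow (by omega)]
      rw [hP, hz0]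
      linarith
    · have hM : (backoffPotential w (j - 1) : ℝ) = backoffPotential w j + 1 := by
        norm_cast
        simp only [backoffPotential, ← hL]
        omega
      rw [hP, hM]
      linarith
  · have hP : (backoffPotential w (j + 1) : ℝ) = backoffPotential w j + 1 := by
      norm_cast
      simp only [backoffPotential, ← hL]
      omega
    have h1 : 2 * w ≤ 3 ^ j := (Nat.clog_le_iff_le_pow (by norm_num)).1 hj
    have h2 : (2 : ℝ) * w ≤ 3 ^ j := by exact_mod_cast h1
    have hwq : w * q ≤ 1 / 2 := by nlinarith
    -- Bernoulli's inequality gives `z ≥ 1 - wq` and, as `wq ≤ 1/2`, also `s ≥ wq / 2`; hence noise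
    -- has probability at most `wq - s ≤ s`.
    have hB : ∀ k : ℕ, 1 - k * q ≤ (1 - q) ^ k := by
      intro k
      have := one_add_mul_le_pow (show (-2 : ℝ) ≤ -q by linarith) k
      rw [← sub_eq_add_neg] at this
      linarith
    have hB1 := hB w
    have hB2 := hB (w - 1)
    rw [Nat.cast_sub hw, Nat.cast_one] at hB2
    have hs2 : w * q ≤ 2 * s := by
      rw [hs]
      have : (1 : ℝ) / 2 ≤ (1 - q) ^ (w - 1) := by linarith
      nlinarith [mul_le_mul_of_nonneg_left this (show 0 ≤ w * q by positivity)]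
    have hn : 1 - z - s ≤ s := by linarith
    rcases eq_or_lt_of_le hj with hj' | hj'
    · have hzs := hzs (hnear hj'.ge)
      have hM : (backoffPotential w (j - 1) : ℝ) = backoffPotential w j + 1 := by
        norm_cast
        simp only [backoffPotential, ← hL]
        omega
      rw [hP, hM]
      linarith
    · have hM : (backoffPotential w (j - 1) : ℝ) = backoffPotential w j - 1 := by
        rw [eq_sub_iff_add_eq]
        norm_cast
        simp only [backoffPotential, ← hL]
        omega
      rw [hP, hM]
      linarith

namespace RandSimple

variable {n m : ℕ} {G : SimpleGraph (Fin n)} (edge : Fin m ≃ G.edgeSet)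

/-! ### The drift of the execution -/

open Classical in
/-- The stations that hold a waiting edge. -/
noncomputable def waitingSet (R : Finset (Sym2 (Fin n))) : Finset (Fin m) :=
  Finset.univ.filter fun p => IsWaiting R (edge p : Sym2 (Fin n))

/-- The potential of the execution at the start of a round; `r` is the size of a spanning
forest. -/
noncomputable def roundPotential (r : ℕ) (R : Finset (Sym2 (Fin n))) (j : ℕ) : ℕ :=
  15 * (r - R.card) + backoffPotential (waitingSet edge R).card j

/-- The potential of the execution. -/
noncomputable def potential (r : ℕ) (g : Global n) : ℕ :=
  match g.label with
  | .A => 3 * roundPotential edge r g.revealed g.exp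
  | .C => 3 * roundPotential edge r g.revealed g.exp + 2
  | .D => 3 * roundPotential edge r g.revealed g.exp + 1
  | .done => 0

variable {edge} {x : Fin m → ℝ} {g : Global n}

theorem mem_waitingSet {R : Finset (Sym2 (Fin n))} {p : Fin m} :
    p ∈ waitingSet edge R ↔ IsWaiting R (edge p : Sym2 (Fin n)) := by
  simp [waitingSet]

theorem card_waitingSet_anti {R S : Finset (Sym2 (Fin n))} (h : R ⊆ S) :
    (waitingSet edge S).card ≤ (waitingSet edge R).card :=
  Finset.card_le_card fun _ hp => mem_waitingSet.2 ((mem_waitingSet.1 hp).anti h)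

theorem roundPotential_anti (r : ℕ) {R S : Finset (Sym2 (Fin n))} (h : R ⊆ S) (j : ℕ) :
    roundPotential edge r S j ≤ roundPotential edge r R j := by
  have h1 := Finset.card_le_card h
  have h2 := backoffPotential_mono (card_waitingSet_anti (edge := edge) h) j
  unfold roundPotential
  omega

theorem globalFeedback_of_mem_noSuccess (hx : ∀ p, x p ∈ Set.Ico (0 : ℝ) 1) (hl : g.label = .A)
    (h : x ∈ noSuccess (waitingSet edge g.revealed) ((3 : ℝ) ^ g.exp)⁻¹) :
    globalFeedback (input edge) x g = .silence := by
  rw [globalFeedback_eq_channel, channel_eq_silence_iff]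
  intro p hp
  rw [broadcasts_of_label_A hx hl] at hp
  exact (h p (mem_waitingSet.2 hp.1)).not_gt hp.2

theorem globalFeedback_of_mem_oneSuccess (hx : ∀ p, x p ∈ Set.Ico (0 : ℝ) 1) (hl : g.label = .A)
    (h : x ∈ oneSuccess (waitingSet edge g.revealed) ((3 : ℝ) ^ g.exp)⁻¹) :
    ∃ p, IsWaiting g.revealed (edge p : Sym2 (Fin n)) ∧
      globalFeedback (input edge) x g = .heard (.edge (edge p)) := by
  simp only [oneSuccess, Set.mem_iUnion] at h
  obtain ⟨p, hp, hlt, hge⟩ := h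
  rw [mem_waitingSet] at hp
  refine ⟨p, hp, ?_⟩
  rw [globalFeedback_eq_channel, channel_of_unique (p := p)]
  · simp [msg, Global.view, hl, input]
  · exact (broadcasts_of_label_A hx hl).2 ⟨hp, hlt⟩
  · intro q hq
    rw [broadcasts_of_label_A hx hl] at hq
    by_contra hne
    exact (hge q (mem_waitingSet.2 hq.1) hne).not_gt hq.2

theorem globalFeedback_of_notMem (hx : ∀ p, x p ∈ Set.Ico (0 : ℝ) 1) (hl : g.label = .A)
    (h0 : x ∉ noSuccess (waitingSet edge g.revealed) ((3 : ℝ) ^ g.exp)⁻¹)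
    (h1 : x ∉ oneSuccess (waitingSet edge g.revealed) ((3 : ℝ) ^ g.exp)⁻¹) :
    globalFeedback (input edge) x g = .noise := by
  rw [globalFeedback_eq_channel]
  apply channel_of_not_existsUnique
  · simp only [noSuccess, Set.mem_ofPred_eq, not_forall, not_le] at h0
    obtain ⟨p, hp, hlt⟩ := h0
    exact ⟨p, (broadcasts_of_label_A hx hl).2 ⟨mem_waitingSet.1 hp, hlt⟩⟩
  · rintro ⟨p, hp, hu⟩
    dsimp only at hp hu
    rw [broadcasts_of_label_A hx hl] at hp
    refine h1 (Set.mem_biUnion (Finset.mem_coe.2 (mem_waitingSet.2 hp.1))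
      ⟨hp.2, fun q hq hne => ?_⟩)
    by_contra hlt
    exact hne (hu q ((broadcasts_of_label_A hx hl).2 ⟨mem_waitingSet.1 hq, not_le.1 hlt⟩))

variable {T : Finset (Sym2 (Fin n))}

/-- A waiting edge extends the revealed forest inside `G`. Consequently the truncated difference in
`roundPotential` really drops by 1 at a success. -/
theorem Invariant.card_lt (hg : Invariant edge g) (hT : IsSpanningForest G T) {p : Fin m}
    (hp : IsWaiting g.revealed (edge p : Sym2 (Fin n))) : g.revealed.card < T.card := by
  have := hp.2.card_le (G := G) (by
    rw [Finset.coe_insert, Set.insert_subset_iff]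
    exact ⟨(edge p).2, hg.subset⟩) hT
  rwa [Finset.card_insert_of_notMem hp.1] at this

/-- Three times the drift of the backoff, of which the summand 2 in the potential at label `C`
reserves one unit for each of steps C and D. -/
theorem drift_of_label_A (hg : Invariant edge g) (hT : IsSpanningForest G T)
    (hl : g.label = .A) :
    ∫⁻ x, (potential edge T.card (globalStep (input edge) x g) : ℝ≥0∞) ∂trials (Fin m) + 1 ≤
      potential edge T.card g := by
  obtain ⟨p₀, hp₀⟩ := hg.exists_isWaiting hl
  have hlt := hg.card_lt hT hp₀
  set W := waitingSet edge g.revealed with hW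
  set ρ := T.card - g.revealed.card with hρ
  have hw : 1 ≤ W.card := Finset.card_pos.2 ⟨p₀, mem_waitingSet.2 hp₀⟩
  have hq0 : 0 ≤ ((3 : ℝ) ^ g.exp)⁻¹ := by positivity
  have hq1 : ((3 : ℝ) ^ g.exp)⁻¹ ≤ 1 :=
    inv_le_one_of_one_le₀ (one_le_pow₀ (by norm_num))
  have hdrift := backoff_drift hw g.exp rfl rfl rfl
  have hpot : potential edge T.card g = 3 * (15 * ρ + backoffPotential W.card g.exp) := by
    rw [potential, hl]
    rfl
  rw [hpot, ← ENNReal.ofReal_natCast]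
  refine lintegral_trials_le W hq0 hq1
    (a := ((3 * (15 * ρ + backoffPotential W.card (g.exp - 1)) + 2 : ℕ) : ℝ))
    (b := ((3 * (15 * (ρ - 1) + backoffPotential W.card g.exp) + 2 : ℕ) : ℝ))
    (c := ((3 * (15 * ρ + backoffPotential W.card (g.exp + 1)) + 2 : ℕ) : ℝ))
    (Nat.cast_nonneg _) (Nat.cast_nonneg _) (Nat.cast_nonneg _) ?_ ?_ ?_ ?_
  · filter_upwards [ae_trials] with x hx h0
    rw [ENNReal.ofReal_natCast, Nat.cast_le, globalStep,
      globalFeedback_of_mem_noSuccess hx hl h0, Global.next, hl]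
    exact le_rfl
  · filter_upwards [ae_trials] with x hx h1
    obtain ⟨p, hp, hf⟩ := globalFeedback_of_mem_oneSuccess hx hl h1
    rw [ENNReal.ofReal_natCast, Nat.cast_le, globalStep, hf, Global.next, hl]
    simp only [potential, roundPotential, revealedAfter, addRevealed_of_isWaiting hp, expAfter,
      Finset.card_insert_of_notMem hp.1]
    have := backoffPotential_mono (card_waitingSet_anti (edge := edge)
      (Finset.subset_insert (edge p : Sym2 (Fin n)) g.revealed)) g.exp
    rw [← hW] at this
    omega
  · filter_upwards [ae_trials] with x hx h0 h1
    rw [ENNReal.ofReal_natCast, Nat.cast_le, globalStep,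
      globalFeedback_of_notMem hx hl h0 h1, Global.next, hl]
    exact le_rfl
  · have hρ1 : ((ρ - 1 : ℕ) : ℝ) = ρ - 1 := by
      rw [Nat.cast_sub (by omega), Nat.cast_one]
    push_cast [hρ1]
    linarith

theorem drift_of_ae_le {f : (Fin m → ℝ) → ℕ} {k : ℕ}
    (h : ∀ x : Fin m → ℝ, (∀ p, x p ∈ Set.Ico (0 : ℝ) 1) → f x + 1 ≤ k) :
    ∫⁻ x, (f x : ℝ≥0∞) ∂trials (Fin m) + 1 ≤ k := by
  -- The all-zero trial is admissible, which makes `k - 1` a genuine difference.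
  have h1 : 1 ≤ k := (Nat.le_add_left 1 _).trans (h 0 (by simp))
  have h2 : ∫⁻ x, (f x : ℝ≥0∞) ∂trials (Fin m) ≤ ∫⁻ _, ((k - 1 : ℕ) : ℝ≥0∞) ∂trials (Fin m) := by
    refine lintegral_mono_ae ?_
    filter_upwards [ae_trials] with x hx
    have := h x hx
    exact_mod_cast (show f x ≤ k - 1 by omega)
  rw [lintegral_const, measure_univ, mul_one] at h2
  calc _ ≤ ((k - 1 : ℕ) : ℝ≥0∞) + 1 := by gcongr
    _ = k := by exact_mod_cast Nat.sub_add_cancel h1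

theorem drift_of_label_C (r : ℕ) (hl : g.label = .C) :
    ∫⁻ x, (potential edge r (globalStep (input edge) x g) : ℝ≥0∞) ∂trials (Fin m) + 1 ≤
      potential edge r g := by
  refine drift_of_ae_le fun x _ => ?_
  have := roundPotential_anti (edge := edge) r
    (subset_revealedAfter g.revealed (globalFeedback (input edge) x g)) g.exp
  simp only [globalStep, Global.next, hl, potential]
  omega

theorem drift_of_label_D (r : ℕ) (hl : g.label = .D) :
    ∫⁻ x, (potential edge r (globalStep (input edge) x g) : ℝ≥0∞) ∂trials (Fin m) + 1 ≤
      potential edge r g := by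
  refine drift_of_ae_le fun x hx => ?_
  by_cases h : ∃ p, IsWaiting g.revealed (edge p : Sym2 (Fin n))
  · rw [globalStep_of_label_D_of_exists hx hl h]
    simp only [hl, potential]
    omega
  · rw [globalStep_of_label_D_of_forall hx hl (not_exists.1 h)]
    simp only [hl, potential]
    omega

open Classical in
theorem Invariant.drift (hg : Invariant edge g) (hT : IsSpanningForest G T) :
    ∫⁻ x, (potential edge T.card (RandSimple.globalStep (input edge) x g) : ℝ≥0∞) ∂trials (Fin m) +
      (if g.label = .done then 0 else 1) ≤ potential edge T.card g := by
  rcases hl : g.label with _ | _ | _ | _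
  · simpa using drift_of_label_A hg hT hl
  · simpa using drift_of_label_C T.card hl
  · simpa using drift_of_label_D T.card hl
  · have : ∀ x, RandSimple.globalStep (input edge) x g = g := fun x => by
      simp [RandSimple.globalStep, Global.next, hl]
    simp [this, potential, hl]

/-- With `r = |T|`: `2m ≤ (1 + 2r) ^ 2 ≤ 9 ^ r`, so the logarithm is at most `2r` and the potential
at most `3 (15 r + 2 · 2r) = 57 r`. -/
theorem potential_init_le (hT : IsSpanningForest G T) :
    potential edge T.card (Global.init n) ≤ 57 * T.card := by
  have h1 : (waitingSet edge (∅ : Finset (Sym2 (Fin n)))).card ≤ m :=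
    (Finset.card_le_univ _).trans (Fintype.card_fin m).le
  have h2 : m ≤ T.card * (2 * T.card + 1) := by
    have := hT.card_edgeSet_le
    rwa [← Nat.card_congr edge, Nat.card_eq_fintype_card, Fintype.card_fin] at this
  have h3 : 1 + T.card * 2 ≤ 3 ^ T.card := by
    exact_mod_cast one_add_mul_le_pow (a := (2 : ℤ)) (by norm_num) T.card
  have h4 : Nat.clog 3 (2 * m) ≤ 2 * T.card := by
    rw [Nat.clog_le_iff_le_pow (by norm_num), mul_comm 2 T.card, pow_mul]
    nlinarith
  have h5 := backoffPotential_mono h1 0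
  simp only [backoffPotential] at h5
  simp only [potential, Global.init, roundPotential, Finset.card_empty, backoffPotential]
  omega

end RandSimple

namespace RandSimple

variable {n m : ℕ}

/-! ### Measurability -/

instance : Countable Label := by
  let f : Label → ℕ
    | .A => 0
    | .C => 1
    | .D => 2
    | .done => 3
  refine Function.Injective.countable (f := f) fun a b h => ?_
  cases a <;> cases b <;> first | rfl | simp [f] at h

instance : Countable (Global n) :=
  Function.Injective.countable
    (f := fun g : Global n => (g.label, g.exp, g.counter, g.revealed)) (by
      intro g h hgh
      simp only [Prod.mk.injEq] at hgh
      exact Global.ext hgh.1 hgh.2.1 hgh.2.2.1 hgh.2.2.2)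

instance : MeasurableSpace (Global n) := ⊤

instance : DiscreteMeasurableSpace (Global n) := ⟨fun _ => trivial⟩

theorem measurable_globalStep (inp : Fin m → Input n) :
    Measurable fun y : (Fin m → ℝ) × Global n => globalStep inp y.1 y.2 := by
  refine measurable_from_prod_countable_left fun g => ?_
  -- For a fixed state the trials matter only through the finitely many success patterns.
  let F : (Fin m → Prop) → Global n := fun B =>
    g.next (channel (fun p => ¬ g.label = .done ∧ B p) fun p => msg (inp p) (g.view (inp p).edge))
  have hB : Measurable fun (x : Fin m → ℝ) (p : Fin m) =>
      x p < prob (inp p) (g.view (inp p).edge) :=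
    measurable_pi_lambda _ fun p =>
      measurableSet_setOfPred.1 (measurableSet_lt (measurable_pi_apply p) measurable_const)
  exact (measurable_of_countable F).comp hB

theorem measurable_globalRun (inp : Fin m → Input n) (t : ℕ) :
    Measurable fun u : ℕ → Fin m → ℝ => globalRun inp u t := by
  induction t with
  | zero => exact measurable_const
  | succ t ih => exact (measurable_globalStep inp).comp ((measurable_pi_apply t).prodMk ih)

theorem globalRun_congr (inp : Fin m → Input n) {u v : ℕ → Fin m → ℝ} {t : ℕ}
    (h : ∀ s < t, u s = v s) : globalRun inp u t = globalRun inp v t := by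
  induction t with
  | zero => rfl
  | succ t ih =>
    rw [globalRun, globalRun, ih fun s hs => h s (by omega), h t (by omega)]

/-! ### Expected running time -/

variable {Ω : Type*} [MeasurableSpace Ω] {P : Measure Ω} {U : ℕ → Fin m → Ω → ℝ}

theorem measurable_trialsAt (hU : ∀ t p, Measurable (U t p)) :
    Measurable fun ω t p => U t p ω :=
  measurable_pi_lambda _ fun t => measurable_pi_lambda _ fun p => hU t p

theorem measurable_globalRun_comp (inp : Fin m → Input n) (hU : ∀ t p, Measurable (U t p))
    (t : ℕ) : Measurable fun ω => globalRun inp (fun t p => U t p ω) t :=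
  (measurable_globalRun inp t).comp (measurable_trialsAt hU)

theorem map_trialsAt [IsProbabilityMeasure P] (hU : ∀ t p, Measurable (U t p))
    (hunif : ∀ t p, pdf.IsUniform (U t p) (Set.Ico (0 : ℝ) 1) P volume)
    (hind : iIndepFun (fun q : ℕ × Fin m => U q.1 q.2) P) (t : ℕ) :
    P.map (fun ω p => U t p ω) = trials (Fin m) := by
  have h : iIndepFun (fun p => U t p) P :=
    hind.precomp (g := fun p => (t, p)) (Prod.mk_right_injective t)
  rw [h.map_fun_eq_pi_map fun p => (hU t p).aemeasurable, trials]
  congr 1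
  funext p
  exact hunif t p

theorem ae_forall_mem_Ico (hU : ∀ t p, Measurable (U t p))
    (hunif : ∀ t p, pdf.IsUniform (U t p) (Set.Ico (0 : ℝ) 1) P volume) :
    ∀ᵐ ω ∂P, ∀ t p, U t p ω ∈ Set.Ico (0 : ℝ) 1 := by
  refine ae_all_iff.2 fun t => ae_all_iff.2 fun p => ?_
  have h : ∀ᵐ y ∂P.map (U t p), y ∈ Set.Ico (0 : ℝ) 1 := by
    rw [hunif t p]
    exact ae_uniformUnit
  exact ae_of_ae_map (hU t p).aemeasurable h

theorem indepFun_globalRun (inp : Fin m → Input n) (hU : ∀ t p, Measurable (U t p))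
    (hind : iIndepFun (fun q : ℕ × Fin m => U q.1 q.2) P) (t : ℕ) :
    IndepFun (fun ω => globalRun inp (fun t p => U t p ω) t) (fun ω p => U t p ω) P := by
  let S₁ : Finset (ℕ × Fin m) := Finset.range t ×ˢ Finset.univ
  let S₂ : Finset (ℕ × Fin m) := {t} ×ˢ Finset.univ
  have hdisj : Disjoint S₁ S₂ := by
    rw [Finset.disjoint_left]
    rintro ⟨s, p⟩ h1 h2
    simp only [S₁, S₂, Finset.mem_product, Finset.mem_range, Finset.mem_singleton] at h1 h2
    omega
  have h := hind.indepFun_finset S₁ S₂ hdisj fun q => hU q.1 q.2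
  -- The trials before step `t`, padded by 0; by `globalRun_congr` the padding does not affect the
  -- state after `t` steps.
  let φ : (S₁ → ℝ) → ℕ → Fin m → ℝ := fun y s p =>
    if hs : (s, p) ∈ S₁ then y ⟨(s, p), hs⟩ else 0
  have hφ : Measurable φ := by
    refine measurable_pi_lambda _ fun s => measurable_pi_lambda _ fun p => ?_
    by_cases hs : (s, p) ∈ S₁
    · simpa only [φ, hs, dif_pos] using measurable_pi_apply _
    · simpa only [φ, hs, dif_neg, not_false_iff] using measurable_const
  let ψ : (S₂ → ℝ) → Fin m → ℝ := fun y p => y ⟨(t, p), by simp [S₂]⟩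
  have hψ : Measurable ψ := measurable_pi_lambda _ fun p => measurable_pi_apply _
  have h' := h.comp ((measurable_globalRun inp t).comp hφ) hψ
  convert! h' using 1
  funext ω
  refine globalRun_congr inp fun s hs => ?_
  funext p
  have : (s, p) ∈ S₁ := by simp [S₁, hs]
  simp [φ, this]

/-- The Markov property: by independence the joint law of state and fresh trials is a product, and
Tonelli's theorem applies. -/
theorem lintegral_globalRun_succ [IsProbabilityMeasure P] (inp : Fin m → Input n)
    (hU : ∀ t p, Measurable (U t p))
    (hunif : ∀ t p, pdf.IsUniform (U t p) (Set.Ico (0 : ℝ) 1) P volume)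
    (hind : iIndepFun (fun q : ℕ × Fin m => U q.1 q.2) P) (t : ℕ) (f : Global n → ℝ≥0∞) :
    ∫⁻ ω, f (globalRun inp (fun t p => U t p ω) (t + 1)) ∂P =
      ∫⁻ ω, ∫⁻ x, f (globalStep inp x (globalRun inp (fun t p => U t p ω) t))
        ∂trials (Fin m) ∂P := by
  have hX := measurable_globalRun_comp inp hU t
  have hV : Measurable fun ω p => U t p ω := measurable_pi_lambda _ fun p => hU t p
  have hF : Measurable fun y : Global n × (Fin m → ℝ) => f (globalStep inp y.2 y.1) :=
    (measurable_of_countable f).comp ((measurable_globalStep inp).comp measurable_swap)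
  have hmap := (indepFun_iff_map_prod_eq_prod_map_map hX.aemeasurable hV.aemeasurable).1
    (indepFun_globalRun inp hU hind t)
  rw [map_trialsAt hU hunif hind t] at hmap
  have : IsProbabilityMeasure (P.map fun ω => globalRun inp (fun t p => U t p ω) t) :=
    Measure.isProbabilityMeasure_map hX.aemeasurable
  calc ∫⁻ ω, f (globalRun inp (fun t p => U t p ω) (t + 1)) ∂P
      = ∫⁻ y, f (globalStep inp y.2 y.1)
          ∂P.map (fun ω => (globalRun inp (fun t p => U t p ω) t, fun p => U t p ω)) :=
        (lintegral_map hF (hX.prodMk hV)).symm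
    _ = ∫⁻ g, ∫⁻ x, f (globalStep inp x g) ∂trials (Fin m)
          ∂P.map (fun ω => globalRun inp (fun t p => U t p ω) t) := by
        rw [hmap, lintegral_prod _ hF.aemeasurable]
    _ = _ := lintegral_map (measurable_of_countable _) hX

variable {G : SimpleGraph (Fin n)} (edge : Fin m ≃ G.edgeSet)

open Classical in
theorem time_eq_tsum (p : Fin m) (u : ℕ → Fin m → ℝ) :
    (((algorithm n).time (input edge) u : ℕ∞) : ℝ≥0∞) =
      ∑' t, if (globalRun (input edge) u t).label = .done then 0 else 1 := by
  have h : ∀ t, (∀ q, (algorithm n).halted ((algorithm n).run (input edge) u t q)) ↔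
      (globalRun (input edge) u t).label = .done := fun t => by
    simp only [halted_run_iff]
    exact ⟨fun h => h p, fun h _ => h⟩
  simp only [Protocol.time, h]
  exact iInf_natCast_eq_tsum fun t => label_globalRun_succ_of_done

/-- With no stations, all of them have vacuously halted at the outset. -/
theorem time_eq_zero_of_isEmpty [IsEmpty (Fin m)] (u : ℕ → Fin m → ℝ) :
    (algorithm n).time (input edge) u = 0 := by
  simp only [Protocol.time]
  exact le_antisymm (iInf₂_le 0 fun p => isEmptyElim p) bot_le

open Classical in
theorem measurable_ite_done (inp : Fin m → Input n) (hU : ∀ t p, Measurable (U t p)) (t : ℕ) :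
    Measurable fun ω => if (globalRun inp (fun t p => U t p ω) t).label = .done
      then (0 : ℝ≥0∞) else 1 :=
  (measurable_of_countable fun g : Global n => if g.label = .done then (0 : ℝ≥0∞) else 1).comp
    (measurable_globalRun_comp inp hU t)

theorem measurable_time (hU : ∀ t p, Measurable (U t p)) :
    Measurable fun ω =>
      (((algorithm n).time (input edge) (fun t p => U t p ω) : ℕ∞) : ℝ≥0∞) := by
  classical
  rcases isEmpty_or_nonempty (Fin m) with h | ⟨⟨p⟩⟩
  · simp only [time_eq_zero_of_isEmpty]
    exact measurable_const
  · simp only [time_eq_tsum edge p]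
    exact Measurable.tsum fun t => measurable_ite_done _ hU t

theorem lintegral_time_le [IsProbabilityMeasure P] (hU : ∀ t p, Measurable (U t p))
    (hunif : ∀ t p, pdf.IsUniform (U t p) (Set.Ico (0 : ℝ) 1) P volume)
    (hind : iIndepFun (fun q : ℕ × Fin m => U q.1 q.2) P) {T : Finset (Sym2 (Fin n))}
    (hT : IsSpanningForest G T) :
    ∫⁻ ω, (((algorithm n).time (input edge) (fun t p => U t p ω) : ℕ∞) : ℝ≥0∞) ∂P ≤
      (57 : ℕ) * T.card := by
  classical
  rcases isEmpty_or_nonempty (Fin m) with h | ⟨⟨p⟩⟩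
  · simp [time_eq_zero_of_isEmpty]
  simp only [time_eq_tsum edge p]
  rw [lintegral_tsum fun t => (measurable_ite_done _ hU t).aemeasurable]
  let X : Ω → ℕ → Global n := fun ω => globalRun (input edge) (fun t p => U t p ω)
  let Ψ : Global n → ℝ≥0∞ := fun g => potential edge T.card g
  have hstep : ∀ t, ∫⁻ ω, Ψ (X ω (t + 1)) ∂P +
      ∫⁻ ω, (if (X ω t).label = .done then 0 else 1) ∂P ≤ ∫⁻ ω, Ψ (X ω t) ∂P := by
    intro t
    rw [lintegral_globalRun_succ (input edge) hU hunif hind t Ψ,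
      ← lintegral_add_right _ (measurable_ite_done _ hU t)]
    refine lintegral_mono_ae ?_
    filter_upwards [ae_forall_mem_Ico hU hunif] with ω hω
    exact (invariant_globalRun p hω t).drift hT
  -- Telescoping the drift: the expected number of steps taken so far plus the remaining mean
  -- potential never exceeds the initial potential.
  have hsum : ∀ N, ∑ t ∈ Finset.range N, ∫⁻ ω, (if (X ω t).label = .done then 0 else 1) ∂P +
      ∫⁻ ω, Ψ (X ω N) ∂P ≤ (57 : ℕ) * T.card := by
    intro N
    induction N with
    | zero =>
      have : ∀ ω, X ω 0 = Global.init n := fun _ => rfl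
      simp only [this, Finset.range_zero, Finset.sum_empty, zero_add, lintegral_const,
        measure_univ, mul_one, Ψ]
      exact_mod_cast potential_init_le (edge := edge) hT
    | succ N ih =>
      rw [Finset.sum_range_succ, add_assoc, add_comm (∫⁻ ω, _ ∂P)]
      exact (add_le_add_right (hstep N) _).trans ih
  exact ENNReal.tsum_le_of_sum_range_le fun N => le_self_add.trans (hsum N)

theorem card_le_lintegral_time [IsProbabilityMeasure P] (hU : ∀ t p, Measurable (U t p))
    (hunif : ∀ t p, pdf.IsUniform (U t p) (Set.Ico (0 : ℝ) 1) P volume)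
    {T : Finset (Sym2 (Fin n))} (hT : IsSpanningForest G T) :
    (T.card : ℝ≥0∞) ≤
      ∫⁻ ω, (((algorithm n).time (input edge) (fun t p => U t p ω) : ℕ∞) : ℝ≥0∞) ∂P := by
  calc (T.card : ℝ≥0∞) = ∫⁻ _, (T.card : ℝ≥0∞) ∂P := by simp
    _ ≤ _ := by
        refine lintegral_mono_ae ?_
        filter_upwards [ae_forall_mem_Ico hU hunif] with ω hω
        exact_mod_cast ENat.toENNReal_le.2 (card_le_time edge hω hT)

end RandSimple

theorem mainTheorem2 :
    ∃ C : ℕ, ∀ (n m : ℕ) (G : SimpleGraph (Fin n)) (edge : Fin m ≃ G.edgeSet),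
      -- every execution stops within `C * m` steps with a spanning forest, heard on the channel
      (∀ u : ℕ → Fin m → ℝ, (∀ t p, u t p ∈ Set.Ico (0 : ℝ) 1) →
        ∃ k : ℕ, (RandSimple.algorithm n).time (RandSimple.input edge) u = (k : ℕ∞) ∧
          k ≤ C * m ∧
          ∃ T : Finset (Sym2 (Fin n)), IsSpanningForest G T ∧
            (∀ e ∈ T, ∃ t < k,
              (RandSimple.algorithm n).feedbackAt (RandSimple.input edge) u t =
                Feedback.heard (RandSimple.Msg.edge e)) ∧
            ∀ p : Fin m,
              ((RandSimple.algorithm n).run (RandSimple.input edge) u k p).revealed = T ∧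
              (((RandSimple.algorithm n).run (RandSimple.input edge) u k p).status =
                RandSimple.Status.revealed ↔ (edge p : Sym2 (Fin n)) ∈ T)) ∧
      -- the expected time, over independent random trials, is proportional to `|T|`
      (∀ (Ω : Type*) [MeasurableSpace Ω] (P : Measure Ω) [IsProbabilityMeasure P]
        (U : ℕ → Fin m → Ω → ℝ),
        (∀ t p, Measurable (U t p)) →
        (∀ t p, pdf.IsUniform (U t p) (Set.Ico (0 : ℝ) 1) P volume) →
        iIndepFun (fun q : ℕ × Fin m => U q.1 q.2) P →
        Measurable (fun ω =>
          (((RandSimple.algorithm n).time (RandSimple.input edge) (fun t p => U t p ω) : ℕ∞) :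
            ℝ≥0∞)) ∧
        ∀ T : Finset (Sym2 (Fin n)), IsSpanningForest G T →
          (T.card : ℝ≥0∞) ≤
            ∫⁻ ω, (((RandSimple.algorithm n).time (RandSimple.input edge)
              (fun t p => U t p ω) : ℕ∞) : ℝ≥0∞) ∂P ∧
          ∫⁻ ω, (((RandSimple.algorithm n).time (RandSimple.input edge)
              (fun t p => U t p ω) : ℕ∞) : ℝ≥0∞) ∂P ≤ (C : ℝ≥0∞) * (T.card : ℝ≥0∞)) := by
  refine ⟨57, fun n m G edge => ⟨fun u hu => ?_, fun Ω _ P _ U hU hunif hind =>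
    ⟨RandSimple.measurable_time edge hU, fun T hT =>
      ⟨RandSimple.card_le_lintegral_time edge hU hunif hT,
        RandSimple.lintegral_time_le edge hU hunif hind hT⟩⟩⟩⟩
  obtain ⟨k, hk, hkm, h⟩ := RandSimple.exists_time_eq edge hu
  -- The deterministic bound is `3 * m`; the constant 57 is needed only for the mean.
  exact ⟨k, hk, by omega, h⟩
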